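/- Let $G=(V,E,\sigma)$ be a signed graph ($G$ simple, $\sigma:E\to\{+1,-1\}$) with $n=|V|$. Write $T_1(G)$ for the number of triangles with exactly one positive edge, and $\Delta_E(G)$, $\Delta_V(G)$ for the maximum number of triangles (of any sign type) containing a given edge, respectively a given vertex. In an insertion-only stream of $G$ each edge arrives exactly once, together with its sign, in an arbitrary order. The signed Jayaram–Kallaugher estimator with sampling probabilities $p_V,p_E\in(0,1]$ uses a hash $h_V:V\to\{0,1\}$, drawn from a finite pairwise independent family with $\Pr[h_V(u)=1]=p_V$ and kept in memory, and independent bits $h_E(e)$ with $\Pr[h_E(e)=1]=p_E$, each drawn when $e$ arrives. It starts with $R_1=0$ and an empty dictionary $S$. When $(vw,\sigma_{vw})$ arrives, it adds $1/(p_Vp_E^2)$ to $R_1$ for each $u$ such that $h_V(u)=1$, $uv,uw\in S$ and either $\sigma_{vw}=+1$, $S[uv]=S[uw]=-1$, or $\sigma_{vw}=-1$, $S[uv]\ne S[uw]$; then, if $h_E(vw)=1$ and ($h_V(v)=1$ or $h_V(w)=1$), it sets $S[vw]=\sigma_{vw}$. The median-of-means algorithm built on it runs $N_\delta$ groups of $N_\epsilon$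 independent copies in parallel and outputs the median over the groups of the mean of $R_1$ in each group; a group whose copies come to store more than a fixed number $B$ of edges in total is abandoned and contributes the value $0$. There is an absolute constant $C>0$ such that the following holds for all integers $n,\bar m,\bar\Delta_E,\bar\Delta_V\ge 0$ and $\bar T\ge1$ and all $\epsilon\in(0,1]$, $\delta\in(0,1/2]$. There are $p_V,p_E$, a pairwise independent family and $N_\epsilon,N_\delta\ge1$, $B\ge0$ such that, for every signed graph $G$ on $n$ vertices with $$|E|\le\bar m,\qquad T_1(G)\ge\bar T,\qquad \Delta_E(G)\le\bar\Delta_E,\qquad \Delta_V(G)\le\bar\Delta_V$$ and every insertion-only stream of $G$, the median-of-means algorithm with these parameters outputs $R$ with $$\Pr\bigl[\,|R-T_1(G)|\le\epsilon\,T_1(G)\,\bigr]\ge1-\delta ,$$ and on all these streams, at all times and for all outcomes of its random choices, its memory is held in at most $$C\,\frac{\bar m}{\bar T}\left(\bar\Delta_E+\sqrt{\bar\Delta_V}\right)\log n\;\frac1{\epsilon^2}\log\frac1\delta$$ bits. In particular, if $\bar m,\bar T,\bar\Delta_E,\bar\Delta_V$ agree with $|E|,T_1(G),\Delta_E(G),\Delta_V(G)$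 up to constant factors, the space is $O\bigl(\frac{m}{T_1}(\Delta_E+\sqrt{\Delta_V})\log n\,\frac1{\epsilon^2}\log\frac1\delta\bigr)$ bits, where $m=|E|$. -/

import Mathlib

open MeasureTheory

namespace SignedStream

/-! ### Signed graphs, signed triangles and the graph parameters -/

/-- A signed graph on the vertex set `{0, …, n-1}`: a simple graph with a sign in `{+1, -1}` on
each edge.  Only the values of `sign` on edges of `graph` are ever used. -/
structure SignedGraph (n : ℕ) where
  graph : SimpleGraph (Fin n)
  sign : Sym2 (Fin n) → ℤˣ

namespace SignedGraph

variable {n : ℕ} (G : SignedGraph n)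

/-- The triangles of `G`, as sets of three pairwise adjacent vertices. -/
def triangles : Set (Finset (Fin n)) := {t | G.graph.IsNClique 3 t}

/-- The positive edges of `G` with both endpoints in `t`. -/
def positiveEdgesIn (t : Finset (Fin n)) : Set (Sym2 (Fin n)) :=
  {e | e ∈ G.graph.edgeSet ∧ (∀ x ∈ e, x ∈ t) ∧ G.sign e = 1}

/-- `T_j`: the number of triangles with exactly `j` positive edges. -/
noncomputable def numTriangles (j : ℕ) : ℕ :=
  {t | t ∈ G.triangles ∧ (G.positiveEdgesIn t).ncard = j}.ncard

/-- `m`: the number of edges. -/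
noncomputable def numEdges : ℕ := G.graph.edgeSet.ncard

/-- `Δ_E`: the maximum number of triangles containing a given edge. -/
noncomputable def maxTrianglesAtEdge : ℕ :=
  ⨆ e : G.graph.edgeSet, {t | t ∈ G.triangles ∧ ∀ x ∈ (e : Sym2 (Fin n)), x ∈ t}.ncard

/-- `Δ_V`: the maximum number of triangles containing a given vertex. -/
noncomputable def maxTrianglesAtVertex : ℕ :=
  ⨆ v : Fin n, {t | t ∈ G.triangles ∧ v ∈ t}.ncard

end SignedGraph

/-- An element `(vw, σ)` of a signed edge stream. -/
structure SignedEdge (n : ℕ) where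
  v : Fin n
  w : Fin n
  sign : ℤˣ

/-- The underlying unordered pair `vw`. -/
def SignedEdge.edge {n : ℕ} (a : SignedEdge n) : Sym2 (Fin n) := s(a.v, a.w)

/-- `l` is an insertion-only stream of `G`: each edge of `G` arrives exactly once, with its sign,
in an arbitrary order (and with its endpoints in an arbitrary order). -/
def IsStreamOf {n : ℕ} (l : List (SignedEdge n)) (G : SignedGraph n) : Prop :=
  (l.map SignedEdge.edge).Nodup ∧
  (∀ e, e ∈ l.map SignedEdge.edge ↔ e ∈ G.graph.edgeSet) ∧
  ∀ a ∈ l, a.sign = G.sign a.edge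

/-! ### Randomized single-pass streaming algorithms and their space -/

/-- A randomized single-pass streaming algorithm for streams over `α`.  The initial memory may
depend on an initial random draw, and each update may use the current memory, the arriving item
and a fresh random draw, and nothing else; in particular whatever is needed of earlier items or
draws has to be kept in the memory.  The output is read off the final memory. -/
structure StreamAlg (α Seed Coin Mem : Type) where
  init : Seed → Mem
  step : Mem → α → Coin → Mem
  out : Mem → ℝ

namespace StreamAlg

variable {α Seed Coin Mem : Type} (A : StreamAlg α Seed Coin Mem)

/-- The memory after reading the stream `l`, where `c i` is the draw made when the `i`-th item
arrives. -/
def run (l : List α) (s : Seed) (c : Fin l.length → Coin) : Mem :=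
  (List.finRange l.length).foldl (fun M i => A.step M (l.get i) (c i)) (A.init s)

/-- Memory contents that can occur at some time during the processing of a stream in `P`. -/
def reachable (P : Set (List α)) : Set Mem :=
  {M | ∃ l ∈ P, ∃ l' : List α, l' <+: l ∧
    ∃ (s : Seed) (c : Fin l'.length → Coin), M = A.run l' s c}

/-- On all streams in `P`, at all times and for all outcomes of the random draws, the memory
contents can be held in `b` bits. -/
def UsesAtMostBits (P : Set (List α)) (b : ℕ) : Prop :=
  ∃ enc : Mem → (Fin b → Bool), Set.InjOn enc (A.reachable P)

/-- The probability that the output on the stream `l` lies in `E`, when the initial draw has law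
`μ` and the draws made at the arrivals have law `ν`, all of them independent. -/
noncomputable def outProb [MeasurableSpace Seed] [MeasurableSpace Coin]
    (μ : Measure Seed) (ν : Measure Coin) (l : List α) (E : Set ℝ) : ENNReal :=
  (μ.prod (Measure.pi fun _ : Fin l.length => ν)) {ω | A.out (A.run l ω.1 ω.2) ∈ E}

end StreamAlg

/-! ### The signed triangle estimator -/

/-- The data of a median-of-means algorithm built on the estimator below: the sampling
probabilities `pV`, `pE`, a pairwise independent family `hV` of `numSeeds` hash functions on the
vertices with marginal probability `pV` (one of them is drawn uniformly, and its index is stored),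
the number `numMean` of runs that are averaged in a group, the number `numGroups` of groups of
which the median is taken, and the number `budget` of edges which a group may store before it is
abandoned. -/
structure Params (n : ℕ) where
  pV : ℝ
  pE : ℝ
  pV_pos : 0 < pV
  pV_le : pV ≤ 1
  pE_pos : 0 < pE
  pE_le : pE ≤ 1
  numSeeds : ℕ
  numSeeds_pos : 0 < numSeeds
  hV : Fin numSeeds → Fin n → Bool
  hV_marginal : ∀ u, ({k | hV k u = true} : Set (Fin numSeeds)).ncard = pV * numSeeds
  hV_pairwise : ∀ u w, u ≠ w →
    ({k | hV k u = true ∧ hV k w = true} : Set (Fin numSeeds)).ncard = pV ^ 2 * numSeeds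
  numMean : ℕ
  numMean_pos : 0 < numMean
  numGroups : ℕ
  numGroups_pos : 0 < numGroups
  budget : ℕ

variable {n : ℕ}

/-- Memory of one run of the estimator: the hash function `h_V` (given by its index), the running
estimate `R₁`, and the dictionary `S` of stored edges and their signs. -/
structure EstMem (θ : Params n) where
  seed : Fin θ.numSeeds
  R : ℝ
  S : Sym2 (Fin n) → Option ℤˣ

/-- At the start `R₁ = 0` and `S` is empty. -/
def estInit (θ : Params n) (k : Fin θ.numSeeds) : EstMem θ := ⟨k, 0, fun _ => none⟩

/-- The vertices `u` at which the arriving edge `a = (vw, σ)` is found to complete a triangle with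
exactly one positive edge: `h_V(u) = 1`, the edges `uv` and `uw` are stored, and either `σ = +1`
and both stored signs are `-1`, or `σ = -1` and the stored signs differ. -/
def detected {θ : Params n} (M : EstMem θ) (a : SignedEdge n) : Set (Fin n) :=
  {u | θ.hV M.seed u = true ∧
    ∃ x y : ℤˣ, M.S s(u, a.v) = some x ∧ M.S s(u, a.w) = some y ∧
      ((a.sign = 1 ∧ x = -1 ∧ y = -1) ∨ (a.sign = -1 ∧ x ≠ y))}

/-- Processing of the edge `a = (vw, σ)`: first `R₁` grows by `1 / (p_V p_E²)` for every detected
triangle, then `S[vw]` is set to `σ` if `h_E(vw) = 1` and (`h_V(v) = 1` or `h_V(w) = 1`).  The bit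
`hE = h_E(vw)` is a fresh one, as every edge arrives only once. -/
noncomputable def estStep {θ : Params n} (M : EstMem θ) (a : SignedEdge n) (hE : Bool) :
    EstMem θ where
  seed := M.seed
  R := M.R + (detected M a).ncard * (1 / (θ.pV * θ.pE ^ 2))
  S := if hE = true ∧ (θ.hV M.seed a.v = true ∨ θ.hV M.seed a.w = true)
    then Function.update M.S a.edge (some a.sign) else M.S

/-- The number of stored edges. -/
noncomputable def EstMem.numStored {θ : Params n} (M : EstMem θ) : ℕ :=
  {e | M.S e ≠ none}.ncard

/-! ### Median of means -/

/-- The median of finitely many real numbers (the mean of the two middle ones if their number is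
even). -/
noncomputable def median {k : ℕ} (x : Fin k → ℝ) : ℝ :=
  if h : 0 < k then
    (x (Tuple.sort x ⟨(k - 1) / 2, by omega⟩) + x (Tuple.sort x ⟨k / 2, by omega⟩)) / 2
  else 0

/-- Memory of one group: that of its `numMean` runs, or `none` once the group is abandoned. -/
abbrev GroupMem (θ : Params n) : Type := Option (Fin θ.numMean → EstMem θ)

/-- All runs of a group read the edge `a`, with separate bits `hE j`; the group is abandoned as
soon as its runs store more than `budget` edges in total. -/
noncomputable def groupStep {θ : Params n} (M : GroupMem θ) (a : SignedEdge n)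
    (hE : Fin θ.numMean → Bool) : GroupMem θ :=
  match M with
  | none => none
  | some f =>
    if ∑ j, (estStep (f j) a (hE j)).numStored ≤ θ.budget
    then some fun j => estStep (f j) a (hE j) else none

/-- The mean of the estimates of a group (zero if the group was abandoned). -/
noncomputable def groupMean {θ : Params n} (M : GroupMem θ) : ℝ :=
  match M with
  | none => 0
  | some f => (∑ j, (f j).R) / θ.numMean

/-- The median-of-means algorithm with the estimator as a subroutine: all runs in all groups
process the stream in parallel, and the output is the median over the groups of the group means. -/
noncomputable def medianOfMeans (θ : Params n) :
    StreamAlg (SignedEdge n) (Fin θ.numGroups → Fin θ.numMean → Fin θ.numSeeds)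
      (Fin θ.numGroups → Fin θ.numMean → Bool) (Fin θ.numGroups → GroupMem θ) where
  init k := fun g => some fun j => estInit θ (k g j)
  step M a hE := fun g => groupStep (M g) a (hE g)
  out M := median fun g => groupMean (M g)

/-- The law of the hash functions `h_V` of all runs: independent and uniform in the family. -/
noncomputable def seedLaw (θ : Params n) :
    Measure (Fin θ.numGroups → Fin θ.numMean → Fin θ.numSeeds) :=
  Measure.pi fun _ => Measure.pi fun _ => ProbabilityTheory.uniformOn Set.univ

/-- The Bernoulli law on `{0, 1}` with success probability `p`. -/
noncomputable def bernoulliLaw (p : ℝ) : Measure Bool :=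
  ENNReal.ofReal p • Measure.dirac true + ENNReal.ofReal (1 - p) • Measure.dirac false

/-- The law of the bits `h_E(vw)` of all runs for one arriving edge: independent, each of them
equal to `1` with probability `p_E`. -/
noncomputable def coinLaw (θ : Params n) : Measure (Fin θ.numGroups → Fin θ.numMean → Bool) :=
  Measure.pi fun _ => Measure.pi fun _ => bernoulliLaw θ.pE

/-! ### The a priori bounds -/

/-- The signed graphs on `n` vertices with at most `m` edges, at least `T` triangles with exactly
one positive edge, at most `DE` triangles on any edge and at most `DV` triangles on any vertex. -/
def boundedGraphs (n m T DE DV : ℕ) : Set (SignedGraph n) :=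
  {G | G.numEdges ≤ m ∧ T ≤ G.numTriangles 1 ∧
    G.maxTrianglesAtEdge ≤ DE ∧ G.maxTrianglesAtVertex ≤ DV}

end SignedStream

/-! Give each triangle with one positive edge its last arriving edge, the opposite vertex `u` (the
apex) and the positions of its two earlier edges (the legs). The estimator detects it exactly when
`h_V(u) = 1` and both leg bits are `1`: a leg contains `u`, so sampling `u` is enough for a leg with
bit `1` to be stored. Hence `R` is a rescaled sum of indicators over `wedges l`, each of probability
`pV * pE ^ 2`, and it is unbiased because wedges correspond bijectively to these triangles
(`runFold_finRange_R`, `IsStreamOf.card_wedges`).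

For the variance, two indicators with different apexes and disjoint legs are uncorrelated; this
needs only pairwise independence. A common apex costs `pV * pE ^ 4`, a common leg `pV * pE ^ 3`, a
common pair of legs `pV * pE ^ 2`. At most `d = min Δ_V m` wedges share an apex and at most `Δ_E`
share a leg, so the variance of `R` is at most `T₁ (d / pV + 2 Δ_E / (pV pE) + 1 / (pV pE²))`. With
`pE = 1 / s` and `s = √d`, the outer terms balance and the bound is `2 s (Δ_E + s) T₁ / pV`.

Chebyshev then asks that `N * pV`, with `N` runs per group, be of order `s (Δ_E + s) / (ε² T)`. The
expected number of stored edges in a group is at most `2 N m pV pE`, of order `m (Δ_E + s) / (ε²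
T)`. Markov lets this be enforced as a hard budget, and the median makes the failure probability
exponentially small in the number of groups (`outProb_ge`).

Space is a count of memory states: a hash index and a detection counter for each run, and the
dictionaries of a group counted jointly against its budget (`card_dictionaries_le`,
`usesAtMostBits_medianOfMeans`). -/

namespace SignedStream

/-! ### The median -/

/-- If fewer than half of the values lie outside an interval, the median lies inside it. -/
theorem median_mem_Icc {k : ℕ} (x : Fin k → ℝ) {lo hi : ℝ}
    (h : 2 * (Finset.univ.filter fun i => x i ∉ Set.Icc lo hi).card < k) :
    median x ∈ Set.Icc lo hi := by
  have hk : 0 < k := by omega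
  have hmono : Monotone (x ∘ Tuple.sort x) := Tuple.monotone_sort x
  set σ := Tuple.sort x with hσ
  have key : ∀ s : Finset (Fin k), (∀ i ∈ s, x (σ i) ∉ Set.Icc lo hi) → 2 * s.card < k := by
    intro s hs
    have : s.card ≤ (Finset.univ.filter fun i => x i ∉ Set.Icc lo hi).card := by
      rw [← Finset.card_map σ.toEmbedding]
      refine Finset.card_le_card fun i hi => ?_
      obtain ⟨j, hj, rfl⟩ := Finset.mem_map.1 hi
      simpa using hs j hj
    omega
  -- If the lower middle value were below `lo`, so would be all `(k - 1) / 2 + 1` sorted values up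
  -- to it, which is at least half of them. The upper middle value is treated symmetrically.
  have hlo : lo ≤ x (σ ⟨(k - 1) / 2, by omega⟩) := by
    by_contra! hc
    have := key (Finset.Iic ⟨(k - 1) / 2, by omega⟩) fun i hi hmem => by
      have h1 : x (σ i) ≤ _ := hmono (Finset.mem_Iic.1 hi)
      exact absurd (hmem.1.trans h1) (not_le.2 hc)
    rw [Fin.card_Iic] at this
    simp only at this
    omega
  have hhi : x (σ ⟨k / 2, by omega⟩) ≤ hi := by
    by_contra! hc
    have := key (Finset.Ici ⟨k / 2, by omega⟩) fun i hi hmem => by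
      have h1 : _ ≤ x (σ i) := hmono (Finset.mem_Ici.1 hi)
      exact absurd (h1.trans hmem.2) (not_le.2 hc)
    rw [Fin.card_Ici] at this
    simp only at this
    omega
  have hle : x (σ ⟨(k - 1) / 2, by omega⟩) ≤ x (σ ⟨k / 2, by omega⟩) :=
    hmono (by simp only [Fin.mk_le_mk]; omega)
  rw [median, dif_pos hk]
  constructor <;> linarith

/-- Among `k` independent trials of an event of probability at most `1/16`, at least half occur
with probability at most `2⁻ᵏ`. -/
theorem measure_half_bad_le {Ω : Type*} [MeasurableSpace Ω] (μ : Measure Ω)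
    [IsProbabilityMeasure μ] (k : ℕ) {B : Set Ω} (hB : μ B ≤ ENNReal.ofReal (1 / 16)) :
    Measure.pi (fun _ : Fin k => μ)
        {ω | ∃ I : Finset (Fin k), k ≤ 2 * I.card ∧ ∀ g ∈ I, ω g ∈ B} ≤
      ENNReal.ofReal ((1 / 2) ^ k) := by
  classical
  have hsub : {ω : Fin k → Ω | ∃ I : Finset (Fin k), k ≤ 2 * I.card ∧ ∀ g ∈ I, ω g ∈ B} ⊆
      ⋃ I ∈ Finset.univ.filter (fun I : Finset (Fin k) => k ≤ 2 * I.card),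
        Set.univ.pi fun g => if g ∈ I then B else Set.univ := by
    rintro ω ⟨I, hI, h⟩
    simp only [Set.mem_iUnion]
    refine ⟨I, by simpa using hI, fun g _ => ?_⟩
    by_cases hg : g ∈ I
    · simpa [hg] using h g hg
    · simp [hg]
  have hone : ∀ I ∈ Finset.univ.filter (fun I : Finset (Fin k) => k ≤ 2 * I.card),
      Measure.pi (fun _ : Fin k => μ) (Set.univ.pi fun g => if g ∈ I then B else Set.univ) ≤
        ENNReal.ofReal ((1 / 4) ^ k) := by
    intro I hI
    have hI' : k ≤ 2 * I.card := by simpa using hI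
    rw [Measure.pi_pi]
    have : ∀ g, μ (if g ∈ I then B else Set.univ) = if g ∈ I then μ B else 1 := by
      intro g; split_ifs <;> simp
    simp_rw [this]
    rw [Finset.prod_ite_mem, Finset.univ_inter, Finset.prod_const]
    calc (μ B) ^ I.card ≤ (ENNReal.ofReal (1 / 16)) ^ I.card := by gcongr
      _ = ENNReal.ofReal ((1 / 4) ^ (2 * I.card)) := by
        rw [← ENNReal.ofReal_pow (by norm_num), pow_mul]; norm_num
      _ ≤ _ := ENNReal.ofReal_le_ofReal
        (pow_le_pow_of_le_one (by norm_num) (by norm_num) hI')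
  -- Union bound over the index sets `I`: there are at most `2 ^ k` of them, each contributing `(1 /
  -- 16) ^ (k / 2) = (1 / 4) ^ k` at most.
  calc _ ≤ _ := measure_mono hsub
    _ ≤ _ := measure_biUnion_finset_le _ _
    _ ≤ ∑ _I ∈ Finset.univ.filter (fun I : Finset (Fin k) => k ≤ 2 * I.card),
        ENNReal.ofReal ((1 / 4) ^ k) := Finset.sum_le_sum hone
    _ ≤ ∑ _I : Finset (Fin k), ENNReal.ofReal ((1 / 4) ^ k) :=
        Finset.sum_le_sum_of_subset (Finset.filter_subset _ _)
    _ = ENNReal.ofReal ((1 / 2) ^ k) := by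
        rw [Finset.sum_const, Finset.card_univ, Fintype.card_finset, Fintype.card_fin, nsmul_eq_mul,
          ← ENNReal.ofReal_natCast, ← ENNReal.ofReal_mul (by positivity)]
        congr 1
        push_cast
        rw [← mul_pow]; norm_num

/-! ### Pairwise independent families -/

theorem ncard_zmod_val_lt {q s : ℕ} [NeZero q] (hs : s ≤ q) :
    {x : ZMod q | x.val < s}.ncard = s := by
  have : {x : ZMod q | x.val < s} = (fun i : ℕ => (i : ZMod q)) '' (Finset.range s : Set ℕ) := by
    ext x
    simp only [Set.mem_ofPred_eq, Set.mem_image, Finset.coe_range, Set.mem_Iio]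
    constructor
    · exact fun h => ⟨x.val, h, ZMod.natCast_zmod_val x⟩
    · rintro ⟨i, hi, rfl⟩
      rwa [ZMod.val_natCast_of_lt (by omega)]
  rw [this, Set.InjOn.ncard_image, Set.ncard_coe_finset, Finset.card_range]
  intro i hi j hj hij
  simp only [Finset.coe_range, Set.mem_Iio] at hi hj
  have := congrArg ZMod.val hij
  rwa [ZMod.val_natCast_of_lt (by omega), ZMod.val_natCast_of_lt (by omega)] at this

theorem Equiv.ncard_setOf_comp {α β : Type*} (e : α ≃ β) (p : β → Prop) :
    {a | p (e a)}.ncard = {b | p b}.ncard := by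
  have : {b | p b} = e '' {a | p (e a)} := by
    ext b
    simp only [Set.mem_ofPred_eq, Set.mem_image]
    exact ⟨fun h => ⟨e.symm b, by simpa using h, by simp⟩, by rintro ⟨a, h, rfl⟩; exact h⟩
  rw [this, Set.ncard_image_of_injective _ e.injective]

/-- The family is `u ↦ a u + b` over the field `ZMod q`, thresholded at `s`. Since `n ≤ q`, distinct
vertices are distinct residues, so `(a, b) ↦ (a u + b, a w + b)` is a bijection and the two values
are independent and uniform. The marginal probability is `s / q`. -/
theorem exists_pairwiseIndependent {n q s : ℕ} (hq : q.Prime) (hn : n ≤ q) (hs : s ≤ q) :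
    ∃ hV : Fin (q * q) → Fin n → Bool,
      (∀ u, ({k | hV k u = true} : Set (Fin (q * q))).ncard = q * s) ∧
      ∀ u w, u ≠ w →
        ({k | hV k u = true ∧ hV k w = true} : Set (Fin (q * q))).ncard = s * s := by
  have := Fact.mk hq
  have e : Fin (q * q) ≃ ZMod q × ZMod q := Fintype.equivOfCardEq (by simp [ZMod.card])
  refine ⟨fun k u => decide (((e k).1 * (u.val : ZMod q) + (e k).2).val < s), fun u => ?_,
    fun u w huw => ?_⟩
  · simp only [decide_eq_true_eq]
    rw [Equiv.ncard_setOf_comp e fun p => (p.1 * (u.val : ZMod q) + p.2).val < s]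
    let f : ZMod q × ZMod q ≃ ZMod q × ZMod q :=
      { toFun := fun p => (p.1, p.1 * (u.val : ZMod q) + p.2)
        invFun := fun p => (p.1, p.2 - p.1 * (u.val : ZMod q))
        left_inv := fun p => by simp
        right_inv := fun p => by simp }
    rw [show {p : ZMod q × ZMod q | (p.1 * (u.val : ZMod q) + p.2).val < s} =
      {p | (f p).2.val < s} from rfl, Equiv.ncard_setOf_comp f fun p => p.2.val < s,
      show {p : ZMod q × ZMod q | p.2.val < s} = Set.univ ×ˢ {x | x.val < s} by
        ext; simp, Set.ncard_prod, ncard_zmod_val_lt hs, Set.ncard_univ, Nat.card_zmod]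
  · simp only [decide_eq_true_eq]
    rw [Equiv.ncard_setOf_comp e fun p => (p.1 * (u.val : ZMod q) + p.2).val < s ∧
      (p.1 * (w.val : ZMod q) + p.2).val < s]
    have hd : (u.val : ZMod q) - (w.val : ZMod q) ≠ 0 := by
      intro h
      have := congrArg ZMod.val (sub_eq_zero.1 h)
      rw [ZMod.val_natCast_of_lt (by omega), ZMod.val_natCast_of_lt (by omega)] at this
      exact huw (Fin.ext this)
    let f : ZMod q × ZMod q ≃ ZMod q × ZMod q :=
      { toFun := fun p => (p.1 * (u.val : ZMod q) + p.2, p.1 * (w.val : ZMod q) + p.2)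
        invFun := fun p => ((p.1 - p.2) / ((u.val : ZMod q) - (w.val : ZMod q)),
          p.1 - (p.1 - p.2) / ((u.val : ZMod q) - (w.val : ZMod q)) * (u.val : ZMod q))
        left_inv := fun p => by
          ext <;> simp only <;> field_simp <;> ring
        right_inv := fun p => by
          ext <;> simp only <;> field_simp <;> ring }
    rw [show {p : ZMod q × ZMod q | (p.1 * (u.val : ZMod q) + p.2).val < s ∧
        (p.1 * (w.val : ZMod q) + p.2).val < s} = {p | (f p).1.val < s ∧ (f p).2.val < s} from rfl,
      Equiv.ncard_setOf_comp f fun p => p.1.val < s ∧ p.2.val < s,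
      show {p : ZMod q × ZMod q | p.1.val < s ∧ p.2.val < s} =
        {x | x.val < s} ×ˢ {x | x.val < s} by ext; simp, Set.ncard_prod, ncard_zmod_val_lt hs]

variable {n : ℕ}

/-! ### The law of one run -/

/-- The law of the hash index and the edge bits of a single run. -/
noncomputable def runLaw (θ : Params n) (L : ℕ) :
    Measure (Fin θ.numSeeds × (Fin L → Bool)) :=
  (ProbabilityTheory.uniformOn Set.univ).prod (Measure.pi fun _ => bernoulliLaw θ.pE)

theorem isProbabilityMeasure_bernoulliLaw {p : ℝ} (h0 : 0 ≤ p) (h1 : p ≤ 1) :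
    IsProbabilityMeasure (bernoulliLaw p) := by
  constructor
  simp only [bernoulliLaw, Measure.coe_add, Measure.coe_smul, Pi.add_apply, Pi.smul_apply,
    measure_univ, smul_eq_mul, mul_one]
  rw [← ENNReal.ofReal_add h0 (by linarith)]
  simp

instance (θ : Params n) : IsProbabilityMeasure (bernoulliLaw θ.pE) :=
  isProbabilityMeasure_bernoulliLaw θ.pE_pos.le θ.pE_le

instance (θ : Params n) : IsProbabilityMeasure
    (ProbabilityTheory.uniformOn (Set.univ : Set (Fin θ.numSeeds))) :=
  ProbabilityTheory.isProbabilityMeasure_uniformOn Set.finite_univ ⟨⟨0, θ.numSeeds_pos⟩, trivial⟩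

instance (θ : Params n) (L : ℕ) : IsProbabilityMeasure (runLaw θ L) := by
  unfold runLaw; infer_instance

theorem bernoulliLaw_true {p : ℝ} : bernoulliLaw p {true} = ENNReal.ofReal p := by
  simp [bernoulliLaw]

theorem uniformOn_real {N : ℕ} (S : Set (Fin N)) :
    (ProbabilityTheory.uniformOn (Set.univ : Set (Fin N))).real S = S.ncard / N := by
  rw [Measure.real, ProbabilityTheory.uniformOn_univ, ENNReal.toReal_div, Measure.count_apply
    (Set.toFinite S).measurableSet]
  have : (S.encard : ENNReal).toReal = (S.encard.toNat : ℝ) := by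
    obtain ⟨m, hm⟩ : ∃ m : ℕ, S.encard = m := ⟨_, (Set.toFinite S).cast_ncard_eq.symm⟩
    rw [hm]
    simp
  simp [Set.ncard_def, this]

theorem runLaw_real_prod (θ : Params n) (L : ℕ) (S : Set (Fin θ.numSeeds)) (A : Finset (Fin L)) :
    (runLaw θ L).real {ω | ω.1 ∈ S ∧ ∀ a ∈ A, ω.2 a = true} =
      S.ncard / θ.numSeeds * θ.pE ^ A.card := by
  have : {ω : Fin θ.numSeeds × (Fin L → Bool) | ω.1 ∈ S ∧ ∀ a ∈ A, ω.2 a = true} =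
      S ×ˢ (Set.univ.pi fun a => if a ∈ A then {true} else Set.univ) := by
    ext ω
    simp only [Set.mem_ofPred_eq, Set.mem_prod, Set.mem_pi, Set.mem_univ, true_imp_iff]
    refine and_congr_right fun _ => forall_congr' fun a => ?_
    by_cases ha : a ∈ A <;> simp [ha]
  rw [this, runLaw, measureReal_prod_prod, uniformOn_real]
  congr 1
  rw [Measure.real, Measure.pi_pi]
  have : ∀ a, bernoulliLaw θ.pE (if a ∈ A then {true} else Set.univ) =
      if a ∈ A then ENNReal.ofReal θ.pE else 1 := by
    intro a; split_ifs
    · exact bernoulliLaw_true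
    · exact measure_univ
  simp_rw [this]
  rw [Finset.prod_ite_mem, Finset.univ_inter, Finset.prod_const, ENNReal.toReal_pow,
    ENNReal.toReal_ofReal θ.pE_pos.le]

/-- The event that the vertex `u` and all the edges at the positions in `A` are sampled. -/
def sampled (θ : Params n) {L : ℕ} (u : Fin n) (A : Finset (Fin L)) :
    Set (Fin θ.numSeeds × (Fin L → Bool)) :=
  {ω | θ.hV ω.1 u = true ∧ ∀ a ∈ A, ω.2 a = true}

theorem numSeeds_ne_zero (θ : Params n) : (θ.numSeeds : ℝ) ≠ 0 :=
  Nat.cast_ne_zero.2 θ.numSeeds_pos.ne'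

theorem runLaw_real_sampled (θ : Params n) {L : ℕ} (u : Fin n) (A : Finset (Fin L)) :
    (runLaw θ L).real (sampled θ u A) = θ.pV * θ.pE ^ A.card := by
  have := runLaw_real_prod θ L {k | θ.hV k u = true} A
  rw [θ.hV_marginal, mul_div_cancel_right₀ _ (numSeeds_ne_zero θ)] at this
  exact this

theorem runLaw_real_sampled_inter (θ : Params n) {L : ℕ} (u w : Fin n) (A B : Finset (Fin L)) :
    (runLaw θ L).real (sampled θ u A ∩ sampled θ w B) =
      (if u = w then θ.pV else θ.pV ^ 2) * θ.pE ^ (A ∪ B).card := by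
  have h := runLaw_real_prod θ L {k | θ.hV k u = true ∧ θ.hV k w = true} (A ∪ B)
  have hset : sampled θ u A ∩ sampled θ w B =
      {ω | ω.1 ∈ {k | θ.hV k u = true ∧ θ.hV k w = true} ∧ ∀ a ∈ A ∪ B, ω.2 a = true} := by
    ext ω
    simp only [sampled, Set.mem_inter_iff, Set.mem_ofPred_eq, Finset.mem_union]
    constructor
    · rintro ⟨⟨h1, h2⟩, h3, h4⟩
      exact ⟨⟨h1, h3⟩, fun a ha => ha.elim (h2 a) (h4 a)⟩
    · rintro ⟨⟨h1, h3⟩, h⟩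
      exact ⟨⟨h1, fun a ha => h a (.inl ha)⟩, h3, fun a ha => h a (.inr ha)⟩
  rw [hset, h]
  congr 1
  split_ifs with huw
  · subst huw
    simp only [and_self]
    rw [θ.hV_marginal, mul_div_cancel_right₀ _ (numSeeds_ne_zero θ)]
  · rw [θ.hV_pairwise u w huw, mul_div_cancel_right₀ _ (numSeeds_ne_zero θ)]

/-! ### The first two moments of a sampled count -/

variable {ι : Type*}

/-- The number of the configurations in `W` that are sampled, where the configuration `τ` consists
of the vertex `u τ` and the edges at the positions `A τ`. -/
noncomputable def sampledCount (θ : Params n) {L : ℕ} (W : Finset ι) (u : ι → Fin n)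
    (A : ι → Finset (Fin L)) (ω : Fin θ.numSeeds × (Fin L → Bool)) : ℝ :=
  ∑ τ ∈ W, (sampled θ (u τ) (A τ)).indicator (fun _ => (1 : ℝ)) ω

theorem integral_sampledCount (θ : Params n) {L : ℕ} (W : Finset ι) (u : ι → Fin n)
    (A : ι → Finset (Fin L)) (hA : ∀ τ ∈ W, (A τ).card = 2) :
    ∫ ω, sampledCount θ W u A ω ∂runLaw θ L = W.card * (θ.pV * θ.pE ^ 2) := by
  unfold sampledCount
  rw [integral_finsetSum _ fun τ _ => Integrable.of_finite]
  rw [Finset.sum_congr rfl fun τ hτ => ?_, Finset.sum_const, nsmul_eq_mul]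
  have := integral_indicator_one (μ := runLaw θ L) (s := sampled θ (u τ) (A τ))
    (Set.toFinite _).measurableSet
  rw [runLaw_real_sampled, hA τ hτ] at this
  exact this

theorem covariance_sampled (θ : Params n) {L : ℕ} (u w : Fin n) (A B : Finset (Fin L)) :
    ProbabilityTheory.covariance ((sampled θ u A).indicator fun _ => (1 : ℝ))
        ((sampled θ w B).indicator fun _ => (1 : ℝ)) (runLaw θ L) =
      (if u = w then θ.pV else θ.pV ^ 2) * θ.pE ^ (A ∪ B).card -
        (θ.pV * θ.pE ^ A.card) * (θ.pV * θ.pE ^ B.card) := by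
  have hI : ∀ S : Set (Fin θ.numSeeds × (Fin L → Bool)),
      ∫ ω, S.indicator (fun _ => (1 : ℝ)) ω ∂runLaw θ L = (runLaw θ L).real S := fun S =>
    integral_indicator_one (μ := runLaw θ L) (Set.toFinite _).measurableSet
  rw [ProbabilityTheory.covariance_eq_sub .of_discrete .of_discrete, hI, hI,
    runLaw_real_sampled, runLaw_real_sampled, ← runLaw_real_sampled_inter, ← hI]
  congr 2
  funext ω
  rw [Pi.mul_apply]
  by_cases h1 : ω ∈ sampled θ u A <;> by_cases h2 : ω ∈ sampled θ w B <;> simp [h1, h2]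

/-- The joint probability is governed by the size of `A ∪ B`, which is 2, 3 or 4. The right side
adds one term for each kind of coincidence, so that it can be summed by counting coincidences. -/
theorem covariance_sampled_le (θ : Params n) {L : ℕ} (u w : Fin n) {A B : Finset (Fin L)}
    (hA : A.card = 2) (hB : B.card = 2) :
    ProbabilityTheory.covariance ((sampled θ u A).indicator fun _ => (1 : ℝ))
        ((sampled θ w B).indicator fun _ => (1 : ℝ)) (runLaw θ L) ≤
      (if w = u then θ.pV * θ.pE ^ 4 else 0) +
        (∑ a ∈ A, if a ∈ B then θ.pV * θ.pE ^ 3 else 0) +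
        (if B = A then θ.pV * θ.pE ^ 2 else 0) := by
  rw [covariance_sampled, hA, hB]
  have hV := θ.pV_pos
  have hV1 := θ.pV_le
  have hE := θ.pE_pos
  have hE1 := θ.pE_le
  have hVV : θ.pV ^ 2 ≤ θ.pV := by nlinarith
  have hif : (if u = w then θ.pV else θ.pV ^ 2) ≤ θ.pV := by split_ifs <;> [rfl; exact hVV]
  have hsq : 0 ≤ θ.pV * θ.pE ^ 2 * (θ.pV * θ.pE ^ 2) := by positivity
  have hs0 : 0 ≤ ∑ a ∈ A, if a ∈ B then θ.pV * θ.pE ^ 3 else 0 :=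
    Finset.sum_nonneg fun a _ => by split_ifs <;> positivity
  have h1 : 0 ≤ (if w = u then θ.pV * θ.pE ^ 4 else 0) := by split_ifs <;> positivity
  have h3 : 0 ≤ (if B = A then θ.pV * θ.pE ^ 2 else 0) := by split_ifs <;> positivity
  by_cases hAB : B = A
  · subst hAB
    rw [if_pos rfl, Finset.union_self, hB]
    have : (if u = w then θ.pV else θ.pV ^ 2) * θ.pE ^ 2 ≤ θ.pV * θ.pE ^ 2 := by gcongr
    linarith
  by_cases hd : Disjoint A B
  · rw [Finset.card_union_of_disjoint hd, hA, hB, show 2 + 2 = 4 from rfl]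
    by_cases huw : u = w
    · subst huw
      simp only [if_true] at *
      linarith
    -- Different vertices and disjoint legs: both products equal `pV ^ 2 * pE ^ 4`, so the
    -- covariance vanishes.
    · rw [if_neg huw]
      nlinarith
  · obtain ⟨a, ha, hb⟩ := Finset.not_disjoint_iff.1 hd
    have hcard : 3 ≤ (A ∪ B).card := by
      by_contra! hlt
      have h2 : A ∪ B = A := (Finset.eq_of_subset_of_card_le Finset.subset_union_left
        (by omega)).symm
      have h3 : B ⊆ A := h2 ▸ Finset.subset_union_right
      exact hAB (Finset.eq_of_subset_of_card_le h3 (by omega))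
    have h4 : (if u = w then θ.pV else θ.pV ^ 2) * θ.pE ^ (A ∪ B).card ≤ θ.pV * θ.pE ^ 3 :=
      mul_le_mul hif (pow_le_pow_of_le_one hE.le hE1 hcard) (by positivity) hV.le
    have h5 : θ.pV * θ.pE ^ 3 ≤ ∑ a ∈ A, if a ∈ B then θ.pV * θ.pE ^ 3 else 0 := by
      refine le_trans ?_ (Finset.single_le_sum (f := fun a => if a ∈ B then θ.pV * θ.pE ^ 3 else 0)
        (fun a _ => by split_ifs <;> positivity) ha)
      simp [hb]
    linarith

/-- Fix `τ` and sum the covariance bounds over `τ'`: at most `d₁` share its vertex, at most `d₂`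
contain each of its two positions, and by `hinj` only `τ` itself has the same legs. -/
theorem variance_sampledCount_le (θ : Params n) {L : ℕ} (W : Finset ι) (u : ι → Fin n)
    (A : ι → Finset (Fin L)) (hA : ∀ τ ∈ W, (A τ).card = 2)
    (hinj : Set.InjOn A W) {d₁ d₂ : ℕ}
    (h₁ : ∀ x, (W.filter fun τ => u τ = x).card ≤ d₁)
    (h₂ : ∀ a, (W.filter fun τ => a ∈ A τ).card ≤ d₂) :
    ProbabilityTheory.variance (sampledCount θ W u A) (runLaw θ L) ≤
      W.card * (d₁ * (θ.pV * θ.pE ^ 4) + 2 * d₂ * (θ.pV * θ.pE ^ 3) + θ.pV * θ.pE ^ 2) := by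
  have hV := θ.pV_pos
  have hE := θ.pE_pos
  unfold sampledCount
  rw [ProbabilityTheory.variance_fun_sum' fun τ _ => .of_discrete, ← nsmul_eq_mul]
  refine Finset.sum_le_card_nsmul _ _ _ fun τ hτ => ?_
  refine (Finset.sum_le_sum fun τ' hτ' =>
    covariance_sampled_le θ (u τ) (u τ') (hA τ hτ) (hA τ' hτ')).trans ?_
  rw [Finset.sum_add_distrib, Finset.sum_add_distrib, Finset.sum_comm]
  refine add_le_add (add_le_add ?_ ?_) ?_
  · rw [← Finset.sum_filter, Finset.sum_const, nsmul_eq_mul]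
    gcongr
    exact h₁ _
  · calc _ ≤ ∑ a ∈ A τ, d₂ * (θ.pV * θ.pE ^ 3) := by
          refine Finset.sum_le_sum fun a _ => ?_
          rw [← Finset.sum_filter, Finset.sum_const, nsmul_eq_mul]
          gcongr
          exact h₂ _
      _ = _ := by rw [Finset.sum_const, hA τ hτ]; simp; ring
  · rw [← Finset.sum_filter, Finset.sum_const, nsmul_eq_mul]
    have : (W.filter fun τ' => A τ' = A τ).card ≤ 1 := by
      rw [Finset.card_le_one]
      intro a ha b hb
      rw [Finset.mem_filter] at ha hb
      exact hinj ha.1 hb.1 (ha.2.trans hb.2.symm)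
    have : ((W.filter fun τ' => A τ' = A τ).card : ℝ) ≤ 1 := by exact_mod_cast this
    nlinarith [mul_pos hV (pow_pos hE 2)]

/-! ### The state of a run -/

/-- The memory of a run with hash index `k` and edge bits `c` after the positions `is` of `l`. -/
noncomputable def runFold (θ : Params n) (l : List (SignedEdge n)) (k : Fin θ.numSeeds)
    (c : Fin l.length → Bool) (is : List (Fin l.length)) : EstMem θ :=
  is.foldl (fun M i => estStep M (l.get i) (c i)) (estInit θ k)

theorem runFold_nil (θ : Params n) (l : List (SignedEdge n)) (k c) :
    runFold θ l k c [] = estInit θ k := rfl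

theorem runFold_concat (θ : Params n) (l : List (SignedEdge n)) (k c is i) :
    runFold θ l k c (is ++ [i]) = estStep (runFold θ l k c is) (l.get i) (c i) := by
  simp [runFold]

theorem runFold_seed (θ : Params n) (l : List (SignedEdge n)) (k c is) :
    (runFold θ l k c is).seed = k := by
  induction is using List.reverseRecOn with
  | nil => rfl
  | append_singleton is i ih => rw [runFold_concat]; exact ih

theorem numStored_le_estStep {θ : Params n} (M : EstMem θ) (a : SignedEdge n) (b : Bool) :
    M.numStored ≤ (estStep M a b).numStored := by
  refine Set.ncard_le_ncard ?_ (Set.toFinite _)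
  intro e he
  simp only [estStep, Set.mem_ofPred_eq] at he ⊢
  split_ifs
  · rw [Function.update_apply]
    split_ifs <;> simp_all
  · exact he

theorem numStored_estInit (θ : Params n) (k : Fin θ.numSeeds) : (estInit θ k).numStored = 0 := by
  simp [EstMem.numStored, estInit]

section Positions

variable {l : List (SignedEdge n)} (hinj : Function.Injective fun i => (l.get i).edge)
include hinj

/-- As every edge occupies a single position, no entry is ever overwritten by a different arrival,
and the dictionary can be read off from the draws. -/
theorem runFold_S_eq_some (θ : Params n) (k c is) (e : Sym2 (Fin n)) (x : ℤˣ) :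
    (runFold θ l k c is).S e = some x ↔ ∃ a ∈ is, (l.get a).edge = e ∧ c a = true ∧
      (θ.hV k (l.get a).v = true ∨ θ.hV k (l.get a).w = true) ∧ (l.get a).sign = x := by
  induction is using List.reverseRecOn with
  | nil => simp [runFold_nil, estInit]
  | append_singleton is i ih =>
    rw [runFold_concat]
    have hex : ∀ P : Fin l.length → Prop, (∃ a ∈ is ++ [i], P a) ↔ (∃ a ∈ is, P a) ∨ P i := by
      intro P
      simp [or_and_right, exists_or]
    rw [hex, ← ih]
    simp only [estStep, runFold_seed]
    split_ifs with h
    · rw [Function.update_apply]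
      split_ifs with he
      · subst he
        rw [ih, Option.some.injEq]
        constructor
        · exact fun hx => .inr ⟨rfl, h.1, h.2, hx⟩
        · rintro (⟨a, -, ha, -, -, hx⟩ | ⟨-, -, -, hx⟩)
          · rwa [hinj ha] at hx
          · exact hx
      · exact ⟨.inl, fun h' => h'.resolve_right fun h'' => he h''.1.symm⟩
    · constructor
      · exact .inl
      · rintro (h' | ⟨-, h1, h2, -⟩)
        · exact h'
        · exact absurd ⟨h1, h2⟩ h

theorem numStored_runFold_le (θ : Params n) (k c is) :
    (runFold θ l k c is).numStored ≤ (Finset.univ.filter fun i => c i = true ∧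
      (θ.hV k (l.get i).v = true ∨ θ.hV k (l.get i).w = true)).card := by
  rw [← Set.ncard_coe_finset]
  refine (Set.ncard_le_ncard (t := (fun i => (l.get i).edge) '' _) ?_
    (Set.toFinite _)).trans (Set.ncard_image_le (Set.toFinite _))
  intro e he
  obtain ⟨x, hx⟩ := Option.ne_none_iff_exists'.1 he
  obtain ⟨a, -, h1, h2, h3, -⟩ := (runFold_S_eq_some hinj θ k c is e x).1 hx
  exact ⟨a, by simpa using ⟨h2, h3⟩, h1⟩

end Positions

/-! ### Wedges -/

/-- A triangle with signs `z`, `x`, `y` has exactly one positive edge. -/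
def OnePositive (z x y : ℤˣ) : Prop := (z = 1 ∧ x = -1 ∧ y = -1) ∨ (z = -1 ∧ x ≠ y)

open Classical in
/-- The triangles with one positive edge, each described by the position `i` of its last edge, its
vertex `u` opposite to that edge, and the positions of its other two edges. -/
noncomputable def wedges (l : List (SignedEdge n)) :
    Finset (Fin l.length × Fin n × Fin l.length × Fin l.length) :=
  Finset.univ.filter fun τ => τ.2.2.1 < τ.1 ∧ τ.2.2.2 < τ.1 ∧
    (l.get τ.2.2.1).edge = s(τ.2.1, (l.get τ.1).v) ∧
    (l.get τ.2.2.2).edge = s(τ.2.1, (l.get τ.1).w) ∧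
    OnePositive (l.get τ.1).sign (l.get τ.2.2.1).sign (l.get τ.2.2.2).sign

theorem mem_wedges {l : List (SignedEdge n)} {i : Fin l.length} {u : Fin n}
    {a b : Fin l.length} : (i, u, a, b) ∈ wedges l ↔ a < i ∧ b < i ∧
      (l.get a).edge = s(u, (l.get i).v) ∧ (l.get b).edge = s(u, (l.get i).w) ∧
      OnePositive (l.get i).sign (l.get a).sign (l.get b).sign := by
  simp [wedges]

/-- The vertex of a wedge that has to be sampled. -/
def wedgeApex {L : ℕ} (τ : Fin L × Fin n × Fin L × Fin L) : Fin n := τ.2.1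

/-- The positions of the edges of a wedge that have to be sampled. -/
def wedgeLegs {L : ℕ} (τ : Fin L × Fin n × Fin L × Fin L) : Finset (Fin L) := {τ.2.2.1, τ.2.2.2}

theorem mem_take_finRange {L m : ℕ} {a : Fin L} :
    a ∈ (List.finRange L).take m ↔ a.val < m := by
  rw [List.mem_take_iff_getElem]
  constructor
  · rintro ⟨j, hj, rfl⟩
    simp at hj ⊢
    omega
  · intro h
    exact ⟨a, by simp [h], by simp⟩

section Positions

variable {l : List (SignedEdge n)} (hinj : Function.Injective fun i => (l.get i).edge)
include hinj

theorem mem_detected_iff (θ : Params n) (k c) (i : Fin l.length) (u : Fin n) :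
    u ∈ detected (runFold θ l k c ((List.finRange l.length).take i)) (l.get i) ↔
      ∃ a b, (i, u, a, b) ∈ wedges l ∧ (k, c) ∈ sampled θ u {a, b} := by
  simp only [detected, Set.mem_ofPred_eq, runFold_seed, runFold_S_eq_some hinj, sampled,
    mem_take_finRange, mem_wedges, Finset.mem_insert, Finset.mem_singleton, forall_eq_or_imp,
    forall_eq, OnePositive]
  constructor
  · rintro ⟨hu, x, y, ⟨a, ha, hae, hac, -, rfl⟩, ⟨b, hb, hbe, hbc, -, rfl⟩, hs⟩
    exact ⟨a, b, ⟨ha, hb, hae, hbe, hs⟩, hu, hac, hbc⟩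
  · rintro ⟨a, b, ⟨ha, hb, hae, hbe, hs⟩, hu, hac, hbc⟩
    -- A leg has the sampled vertex `u` as an endpoint, so the vertex condition for storing it is
    -- automatic.
    have key : ∀ (a : Fin l.length) (z : Fin n), (l.get a).edge = s(u, z) →
        θ.hV k (l.get a).v = true ∨ θ.hV k (l.get a).w = true := by
      intro a z h
      rcases Sym2.eq_iff.1 h with ⟨h, -⟩ | ⟨-, h⟩
      · exact .inl (h ▸ hu)
      · exact .inr (h ▸ hu)
    exact ⟨hu, _, _, ⟨a, ha, hae, hac, key a _ hae, rfl⟩, ⟨b, hb, hbe, hbc, key b _ hbe, rfl⟩, hs⟩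

/-- Detections are counted by vertices, wedges by quadruples. The counts agree because the last
position and the apex determine both leg edges, hence both leg positions. -/
theorem ncard_detected (θ : Params n) (k c) (i : Fin l.length) :
    ((detected (runFold θ l k c ((List.finRange l.length).take i)) (l.get i)).ncard : ℝ) =
      ∑ τ ∈ (wedges l).filter (fun τ => τ.1 = i),
        (sampled θ (wedgeApex τ) (wedgeLegs τ)).indicator (fun _ => (1 : ℝ)) (k, c) := by
  classical
  simp only [Set.indicator_apply]
  rw [Finset.sum_boole, Nat.cast_inj]
  have : detected (runFold θ l k c ((List.finRange l.length).take i)) (l.get i) =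
      (wedgeApex (L := l.length)) '' ((((wedges l).filter fun τ => τ.1 = i).filter
        fun τ => (k, c) ∈ sampled θ (wedgeApex τ) (wedgeLegs τ) : Finset _) : Set _) := by
    ext u
    rw [mem_detected_iff hinj]
    simp only [Set.mem_image, SetLike.mem_coe, Finset.mem_filter]
    constructor
    · rintro ⟨a, b, h1, h2⟩
      exact ⟨(i, u, a, b), ⟨⟨h1, rfl⟩, h2⟩, rfl⟩
    · rintro ⟨⟨i', u', a, b⟩, ⟨⟨h1, rfl⟩, h2⟩, rfl⟩
      exact ⟨a, b, h1, h2⟩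
  rw [this, Set.InjOn.ncard_image, Set.ncard_coe_finset]
  rintro ⟨i₁, u₁, a₁, b₁⟩ h1 ⟨i₂, u₂, a₂, b₂⟩ h2 hu
  simp only [SetLike.mem_coe, Finset.mem_filter, mem_wedges] at h1 h2
  obtain ⟨⟨⟨-, -, ha1, hb1, -⟩, rfl⟩, -⟩ := h1
  obtain ⟨⟨⟨-, -, ha2, hb2, -⟩, rfl⟩, -⟩ := h2
  have hu : u₁ = u₂ := hu
  subst hu
  have ha : a₁ = a₂ := hinj (ha1.trans ha2.symm)
  have hb : b₁ = b₂ := hinj (hb1.trans hb2.symm)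
  rw [ha, hb]

theorem runFold_take_R (θ : Params n) (k c) (m : ℕ) (hm : m ≤ l.length) :
    (runFold θ l k c ((List.finRange l.length).take m)).R =
      (∑ τ ∈ (wedges l).filter (fun τ => τ.1.val < m),
        (sampled θ (wedgeApex τ) (wedgeLegs τ)).indicator (fun _ => (1 : ℝ)) (k, c)) *
        (1 / (θ.pV * θ.pE ^ 2)) := by
  classical
  induction m with
  | zero => simp [runFold_nil, estInit]
  | succ m ih =>
    have hm' : m < l.length := hm
    have htake : (List.finRange l.length).take (m + 1) =
        (List.finRange l.length).take m ++ [⟨m, hm'⟩] := by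
      rw [List.take_succ_eq_append_getElem (by simpa using hm')]
      simp
    have hsplit : (wedges l).filter (fun τ => τ.1.val < m + 1) =
        (wedges l).filter (fun τ => τ.1.val < m) ∪ (wedges l).filter (fun τ => τ.1 = ⟨m, hm'⟩) := by
      rw [← Finset.filter_or]
      refine Finset.filter_congr fun τ _ => ?_
      rw [Fin.ext_iff]
      simp only
      omega
    rw [htake, runFold_concat, hsplit, Finset.sum_union, add_mul, ← ih hm'.le,
      ← ncard_detected hinj]
    · rfl
    · refine Finset.disjoint_filter.2 fun τ _ h1 h2 => ?_
      rw [h2] at h1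
      simp at h1

theorem runFold_finRange_R (θ : Params n) (k c) :
    (runFold θ l k c (List.finRange l.length)).R =
      sampledCount θ (wedges l) wedgeApex wedgeLegs (k, c) * (1 / (θ.pV * θ.pE ^ 2)) := by
  have h := runFold_take_R hinj θ k c l.length le_rfl
  rw [List.take_of_length_le (by simp)] at h
  rw [h, sampledCount, Finset.filter_true_of_mem fun τ _ => τ.1.isLt]

end Positions

/-! ### Wedges of a stream and triangles of the graph -/

theorem ncard_positiveEdgesIn (G : SignedGraph n) {u v w : Fin n} (huv : G.graph.Adj u v)
    (huw : G.graph.Adj u w) (hvw : G.graph.Adj v w) :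
    (G.positiveEdgesIn {u, v, w}).ncard = (if G.sign s(u, v) = 1 then 1 else 0) +
      ((if G.sign s(u, w) = 1 then 1 else 0) + if G.sign s(v, w) = 1 then 1 else 0) := by
  have hset : G.positiveEdgesIn {u, v, w} =
      (({s(u, v), s(u, w), s(v, w)} : Finset (Sym2 (Fin n))).filter fun e => G.sign e = 1 :
        Finset _) := by
    ext e
    induction e using Sym2.ind with
    | _ x y =>
      simp only [SignedGraph.positiveEdgesIn, Set.mem_ofPred_eq, SimpleGraph.mem_edgeSet,
        Sym2.mem_iff, forall_eq_or_imp, forall_eq, Finset.mem_insert, Finset.mem_singleton,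
        Finset.coe_filter, ← and_assoc]
      refine and_congr_left fun _ => ?_
      have h1 := huv.ne
      have h2 := huw.ne
      have h3 := hvw.ne
      constructor
      · rintro ⟨⟨hadj, hx⟩, hy⟩
        have hne := hadj.ne
        rcases hx with rfl | rfl | rfl <;> rcases hy with rfl | rfl | rfl <;>
          simp_all [Sym2.eq_swap]
      · intro h
        rcases h with h | h | h <;> rcases Sym2.eq_iff.1 h with ⟨rfl, rfl⟩ | ⟨rfl, rfl⟩ <;>
          simp [huv, huw, hvw, huv.symm, huw.symm, hvw.symm]
  have h1 := huv.ne
  have h2 := huw.ne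
  have h3 := hvw.ne
  rw [hset, Set.ncard_coe_finset, Finset.card_filter, Finset.sum_insert, Finset.sum_insert,
    Finset.sum_singleton]
  · simp [h1, h2, h3.symm]
  · simp [h1, h2, h3, h1.symm]

theorem onePositive_iff (z x y : ℤˣ) : OnePositive z x y ↔
    (if x = 1 then 1 else 0) + ((if y = 1 then 1 else 0) + if z = 1 then 1 else 0) = 1 := by
  unfold OnePositive
  rcases Int.units_eq_one_or x with rfl | rfl <;> rcases Int.units_eq_one_or y with rfl | rfl <;>
    rcases Int.units_eq_one_or z with rfl | rfl <;> decide

/-- The vertex set of the triangle described by a wedge. -/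
def wedgeTriangle (l : List (SignedEdge n))
    (τ : Fin l.length × Fin n × Fin l.length × Fin l.length) : Finset (Fin n) :=
  {τ.2.1, (l.get τ.1).v, (l.get τ.1).w}

theorem edge_subset_wedgeTriangle {l : List (SignedEdge n)} {i : Fin l.length} {u : Fin n}
    {a b : Fin l.length}
    (h : (i, u, a, b) ∈ wedges l) {j : Fin l.length} (hj : j = i ∨ j = a ∨ j = b) :
    ∀ x ∈ (l.get j).edge, x ∈ wedgeTriangle l (i, u, a, b) := by
  obtain ⟨-, -, ha, hb, -⟩ := mem_wedges.1 h
  have hi : (l.get i).edge = s((l.get i).v, (l.get i).w) := rfl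
  rcases hj with rfl | rfl | rfl
  · rw [hi]; simp [wedgeTriangle]
  · rw [ha]; simp [wedgeTriangle]
  · rw [hb]; simp [wedgeTriangle]

section Stream

variable {l : List (SignedEdge n)} {G : SignedGraph n} (hl : IsStreamOf l G)
include hl

theorem IsStreamOf.injective : Function.Injective fun i => (l.get i).edge := by
  have := List.nodup_iff_injective_get.1 hl.1
  intro i j hij
  have h := @this ⟨i, by simp⟩ ⟨j, by simp⟩ (by simpa using hij)
  simpa [Fin.ext_iff] using h

theorem IsStreamOf.adj {i : Fin l.length} {x y : Fin n} (h : (l.get i).edge = s(x, y)) :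
    G.graph.Adj x y := by
  have := (hl.2.1 s(x, y)).1 (h ▸ List.mem_map_of_mem (List.get_mem l i))
  simpa using this

theorem IsStreamOf.exists_pos {x y : Fin n} (h : G.graph.Adj x y) :
    ∃ i : Fin l.length, (l.get i).edge = s(x, y) := by
  have := (hl.2.1 s(x, y)).2 (by simpa using h)
  obtain ⟨a, ha, hae⟩ := List.mem_map.1 this
  obtain ⟨i, rfl⟩ := List.get_of_mem ha
  exact ⟨i, hae⟩

theorem IsStreamOf.sign_eq {i : Fin l.length} {e : Sym2 (Fin n)} (h : (l.get i).edge = e) :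
    (l.get i).sign = G.sign e := by
  rw [hl.2.2 _ (List.get_mem l i), h]

theorem IsStreamOf.length_eq : l.length = G.numEdges := by
  have : G.graph.edgeSet = ((l.map SignedEdge.edge).toFinset : Set _) := by
    ext e
    rw [← hl.2.1 e]
    simp
  rw [SignedGraph.numEdges, this, Set.ncard_coe_finset, List.toFinset_card_of_nodup hl.1]
  simp

theorem IsStreamOf.wedge_adj {i : Fin l.length} {u : Fin n} {a b : Fin l.length}
    (h : (i, u, a, b) ∈ wedges l) : G.graph.Adj u (l.get i).v ∧ G.graph.Adj u (l.get i).w ∧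
      G.graph.Adj (l.get i).v (l.get i).w := by
  obtain ⟨-, -, ha, hb, -⟩ := mem_wedges.1 h
  exact ⟨hl.adj ha, hl.adj hb, hl.adj (i := i) rfl⟩

theorem IsStreamOf.onePositive_iff {i : Fin l.length} {u : Fin n} {a b : Fin l.length}
    (ha : (l.get a).edge = s(u, (l.get i).v)) (hb : (l.get b).edge = s(u, (l.get i).w)) :
    OnePositive (l.get i).sign (l.get a).sign (l.get b).sign ↔
      (G.positiveEdgesIn {u, (l.get i).v, (l.get i).w}).ncard = 1 := by
  rw [ncard_positiveEdgesIn G (hl.adj ha) (hl.adj hb) (hl.adj (i := i) rfl), hl.sign_eq ha,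
    hl.sign_eq hb, hl.sign_eq (i := i) rfl, SignedStream.onePositive_iff]
  rfl

theorem IsStreamOf.wedgeTriangle_mem {τ} (h : τ ∈ wedges l) :
    wedgeTriangle l τ ∈ G.triangles := by
  obtain ⟨i, u, a, b⟩ := τ
  obtain ⟨h1, h2, h3⟩ := hl.wedge_adj h
  exact SimpleGraph.is3Clique_triple_iff.2 ⟨h1, h2, h3⟩

/-- Every edge of the triangle of a wedge arrives at one of its three positions. -/
theorem IsStreamOf.eq_of_edge_subset {i : Fin l.length} {u : Fin n} {a b : Fin l.length}
    (h : (i, u, a, b) ∈ wedges l) {j : Fin l.length}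
    (hj : ∀ x ∈ (l.get j).edge, x ∈ wedgeTriangle l (i, u, a, b)) : j = i ∨ j = a ∨ j = b := by
  obtain ⟨-, -, ha, hb, -⟩ := mem_wedges.1 h
  have hinj := hl.injective
  have hv := hj (l.get j).v (Sym2.mem_mk_left _ _)
  have hw := hj (l.get j).w (Sym2.mem_mk_right _ _)
  have hne : (l.get j).v ≠ (l.get j).w := (hl.adj (i := j) rfl).ne
  have hi : (l.get i).edge = s((l.get i).v, (l.get i).w) := rfl
  have he : (l.get j).edge = s((l.get j).v, (l.get j).w) := rfl
  have : (l.get j).edge = (l.get i).edge ∨ (l.get j).edge = (l.get a).edge ∨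
      (l.get j).edge = (l.get b).edge := by
    simp only [wedgeTriangle, Finset.mem_insert, Finset.mem_singleton] at hv hw
    rw [ha, hb, hi, he]
    rcases hv with hv | hv | hv <;> rcases hw with hw | hw | hw <;> rw [hv, hw] at hne ⊢ <;>
      simp_all [Sym2.eq_swap]
  exact this.imp (fun h => hinj h) (Or.imp (fun h => hinj h) fun h => hinj h)

theorem IsStreamOf.wedge_eq {i : Fin l.length} {u u' : Fin n} {a b a' b' : Fin l.length}
    (h : (i, u, a, b) ∈ wedges l) (h' : (i, u', a', b') ∈ wedges l) (hu : u = u') :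
    ((i, u, a, b) : Fin l.length × Fin n × Fin l.length × Fin l.length) = (i, u', a', b') := by
  subst hu
  obtain ⟨-, -, ha, hb, -⟩ := mem_wedges.1 h
  obtain ⟨-, -, ha', hb', -⟩ := mem_wedges.1 h'
  rw [hl.injective (ha.trans ha'.symm), hl.injective (hb.trans hb'.symm)]

/-- The vertex set determines the three edges; the latest of them is the closing edge, and the
vertex off that edge is the apex. -/
theorem IsStreamOf.injOn_wedgeTriangle : Set.InjOn (wedgeTriangle l) (wedges l) := by
  rintro ⟨i, u, a, b⟩ h ⟨i', u', a', b'⟩ h' heq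
  rw [Finset.mem_coe] at h h'
  have h1 := hl.eq_of_edge_subset h (j := i') (heq ▸ edge_subset_wedgeTriangle h' (.inl rfl))
  have h2 := hl.eq_of_edge_subset h' (j := i) (heq ▸ edge_subset_wedgeTriangle h (.inl rfl))
  obtain ⟨l1, l2, -⟩ := mem_wedges.1 h
  obtain ⟨l3, l4, -⟩ := mem_wedges.1 h'
  -- Each closing position is among the three positions of the other wedge, and each is the strict
  -- maximum of its own triple.
  have hi : i = i' := by
    rcases h1 with h1 | rfl | rfl
    · exact h1.symm
    all_goals
      rcases h2 with h2 | rfl | rfl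
      · exact h2
      all_goals omega
  subst hi
  refine hl.wedge_eq h h' ?_
  obtain ⟨g1, g2, -⟩ := hl.wedge_adj h
  have : u ∈ wedgeTriangle l (i, u', a', b') := heq ▸ by simp [wedgeTriangle]
  simp only [wedgeTriangle, Finset.mem_insert, Finset.mem_singleton] at this
  exact this.resolve_right (not_or.2 ⟨g1.ne, g2.ne⟩)

theorem IsStreamOf.image_wedgeTriangle : wedgeTriangle l '' (wedges l) =
    {t | t ∈ G.triangles ∧ (G.positiveEdgesIn t).ncard = 1} := by
  ext t
  constructor
  · rintro ⟨⟨i, u, a, b⟩, h, rfl⟩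
    rw [Finset.mem_coe] at h
    refine ⟨hl.wedgeTriangle_mem h, ?_⟩
    obtain ⟨-, -, ha, hb, hs⟩ := mem_wedges.1 h
    exact (hl.onePositive_iff ha hb).1 hs
  · rintro ⟨ht, hpos⟩
    have hcl : G.graph.IsNClique 3 t := ht
    classical
    -- The latest position of an edge inside `t` is taken as the closing position `i`.
    have hne : (Finset.univ.filter fun j => ∀ x ∈ (l.get j).edge, x ∈ t).Nonempty := by
      obtain ⟨x, y, z, hxy, hxz, hyz, rfl⟩ := SimpleGraph.is3Clique_iff.1 hcl
      obtain ⟨i, hi⟩ := hl.exists_pos hxy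
      exact ⟨i, by simp [-List.get_eq_getElem, hi]⟩
    obtain ⟨i, hi, hmax⟩ := Finset.exists_max_image _ id hne
    simp only [Finset.mem_filter, Finset.mem_univ, true_and, id] at hi hmax
    have hv := hi (l.get i).v (Sym2.mem_mk_left _ _)
    have hw := hi (l.get i).w (Sym2.mem_mk_right _ _)
    have hvw : (l.get i).v ≠ (l.get i).w := (hl.adj (i := i) rfl).ne
    obtain ⟨u, hu⟩ : ∃ u, u ∈ t \ {(l.get i).v, (l.get i).w} := by
      rw [← Finset.Nonempty, ← Finset.card_pos]
      have := Finset.le_card_sdiff {(l.get i).v, (l.get i).w} t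
      rw [hcl.card_eq, Finset.card_pair hvw] at this
      omega
    simp only [Finset.mem_sdiff, Finset.mem_insert, Finset.mem_singleton, not_or] at hu
    obtain ⟨hut, huv, huw⟩ := hu
    obtain ⟨a, ha⟩ := hl.exists_pos (hcl.isClique hut hv huv)
    obtain ⟨b, hb⟩ := hl.exists_pos (hcl.isClique hut hw huw)
    have hai : a ≤ i := hmax a (by rw [ha]; simp [-List.get_eq_getElem, hut, hv])
    have hbi : b ≤ i := hmax b (by rw [hb]; simp [-List.get_eq_getElem, hut, hw])
    have hedge : (l.get i).edge = s((l.get i).v, (l.get i).w) := rfl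
    have hane : a ≠ i := by
      rintro rfl
      rw [hedge, Sym2.eq_iff] at ha
      rcases ha with h | h
      · exact huv h.1.symm
      · exact huw h.2.symm
    have hbne : b ≠ i := by
      rintro rfl
      rw [hedge, Sym2.eq_iff] at hb
      rcases hb with h | h
      · exact huv h.1.symm
      · exact hvw h.1
    have htri : ({u, (l.get i).v, (l.get i).w} : Finset (Fin n)) = t := by
      refine Finset.eq_of_subset_of_card_le ?_ ?_
      · intro x hx
        simp only [Finset.mem_insert, Finset.mem_singleton] at hx
        rcases hx with rfl | rfl | rfl <;> assumption
      · rw [hcl.card_eq, Finset.card_insert_of_notMem (by simp [-List.get_eq_getElem, huv, huw]),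
          Finset.card_pair hvw]
    refine ⟨(i, u, a, b), ?_, htri⟩
    rw [Finset.mem_coe, mem_wedges]
    exact ⟨lt_of_le_of_ne hai hane, lt_of_le_of_ne hbi hbne, ha, hb,
      (hl.onePositive_iff ha hb).2 (htri ▸ hpos)⟩

theorem IsStreamOf.card_wedges : (wedges l).card = G.numTriangles 1 := by
  rw [SignedGraph.numTriangles, ← hl.image_wedgeTriangle, hl.injOn_wedgeTriangle.ncard_image,
    Set.ncard_coe_finset]

theorem IsStreamOf.card_wedgeLegs {τ} (h : τ ∈ wedges l) : (wedgeLegs τ).card = 2 := by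
  obtain ⟨i, u, a, b⟩ := τ
  obtain ⟨-, -, ha, hb, -⟩ := mem_wedges.1 h
  refine Finset.card_pair ?_
  rintro (rfl : a = b)
  have h' := ha.symm.trans hb
  have := (hl.wedge_adj h).2.2.ne
  simp_all

/-- The two legs of a wedge together cover all three vertices, so they determine the triangle and
hence the wedge. -/
theorem IsStreamOf.injOn_wedgeLegs : Set.InjOn (wedgeLegs (n := n) (L := l.length)) (wedges l) := by
  rintro ⟨i, u, a, b⟩ h ⟨i', u', a', b'⟩ h' heq
  rw [Finset.mem_coe] at h h'
  have hedges : ({(l.get a).edge, (l.get b).edge} : Finset _) =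
      {(l.get a').edge, (l.get b').edge} := by
    have := congrArg (Finset.image fun j => (l.get j).edge) heq
    simpa only [wedgeLegs, Finset.image_insert, Finset.image_singleton] using this
  refine hl.injOn_wedgeTriangle h h' ?_
  obtain ⟨-, -, ha, hb, -⟩ := mem_wedges.1 h
  obtain ⟨-, -, ha', hb', -⟩ := mem_wedges.1 h'
  have key : ∀ τ ∈ wedges l, ∀ x, x ∈ wedgeTriangle l τ ↔
      ∃ e ∈ ({(l.get τ.2.2.1).edge, (l.get τ.2.2.2).edge} : Finset _), x ∈ e := by
    rintro ⟨i, u, a, b⟩ h x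
    obtain ⟨-, -, ha, hb, -⟩ := mem_wedges.1 h
    simp only [wedgeTriangle, Finset.mem_insert, Finset.mem_singleton, exists_eq_or_imp,
      exists_eq_left, ha, hb, Sym2.mem_iff]
    tauto
  ext x
  rw [key _ h, key _ h']
  simp only [hedges]

/-- The bound by the number of edges holds since the apex and the closing edge determine the wedge.
It matters when the given bound on `Δ_V` is loose: it keeps the number of runs under control. -/
theorem IsStreamOf.card_wedges_apex_le (x : Fin n) :
    ((wedges l).filter fun τ => wedgeApex τ = x).card ≤
      min G.maxTrianglesAtVertex G.numEdges := by
  refine le_min ?_ ?_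
  · refine le_trans ?_ (le_ciSup (f := fun v : Fin n => {t | t ∈ G.triangles ∧ v ∈ t}.ncard)
      (Set.finite_range _).bddAbove x)
    rw [← Set.ncard_coe_finset]
    refine Set.ncard_le_ncard_of_injOn (wedgeTriangle l) ?_ ?_ (Set.toFinite _)
    · rintro τ hτ
      simp only [Finset.coe_filter, Set.mem_ofPred_eq] at hτ
      refine ⟨hl.wedgeTriangle_mem hτ.1, ?_⟩
      rw [← hτ.2]
      simp [wedgeTriangle, wedgeApex]
    · exact hl.injOn_wedgeTriangle.mono fun τ hτ => (Finset.mem_filter.1 hτ).1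
  · refine (Finset.card_le_card_of_injOn (t := Finset.univ) Prod.fst
      (fun _ _ => Finset.mem_univ _) ?_).trans (by simp [← hl.length_eq])
    rintro ⟨i, u, a, b⟩ h ⟨i', u', a', b'⟩ h' (rfl : i = i')
    rw [Finset.mem_coe, Finset.mem_filter] at h h'
    exact hl.wedge_eq h.1 h'.1 (h.2.trans h'.2.symm)

theorem IsStreamOf.card_filter_edge_le (p : _ → Prop) [DecidablePred p] (j : Fin l.length)
    (hp : ∀ τ ∈ wedges l, p τ → j = τ.1 ∨ j = τ.2.2.1 ∨ j = τ.2.2.2) :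
    ((wedges l).filter p).card ≤ G.maxTrianglesAtEdge := by
  have he : (l.get j).edge ∈ G.graph.edgeSet :=
    (hl.2.1 _).1 (List.mem_map_of_mem (List.get_mem l j))
  refine le_trans ?_ (le_ciSup
    (f := fun e : G.graph.edgeSet =>
      {t | t ∈ G.triangles ∧ ∀ x ∈ (e : Sym2 (Fin n)), x ∈ t}.ncard)
    (Set.finite_range _).bddAbove ⟨_, he⟩)
  rw [← Set.ncard_coe_finset]
  refine Set.ncard_le_ncard_of_injOn (wedgeTriangle l) ?_ ?_ (Set.toFinite _)
  · rintro ⟨i, u, a, b⟩ hτ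
    simp only [Finset.coe_filter, Set.mem_ofPred_eq] at hτ
    exact ⟨hl.wedgeTriangle_mem hτ.1, edge_subset_wedgeTriangle hτ.1 (hp _ hτ.1 hτ.2)⟩
  · exact hl.injOn_wedgeTriangle.mono fun τ hτ => (Finset.mem_filter.1 hτ).1

theorem IsStreamOf.card_wedges_leg_le (j : Fin l.length) :
    ((wedges l).filter fun τ => j ∈ wedgeLegs τ).card ≤ G.maxTrianglesAtEdge :=
  hl.card_filter_edge_le _ j fun τ _ h => .inr (by simpa [wedgeLegs] using h)

theorem IsStreamOf.numTriangles_le_edges_mul :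
    G.numTriangles 1 ≤ G.numEdges * G.maxTrianglesAtEdge := by
  rw [← hl.card_wedges, ← hl.length_eq, mul_comm]
  have := Finset.card_le_mul_card_image_of_maps_to (s := wedges l) (t := Finset.univ)
    (f := Prod.fst) (fun _ _ => Finset.mem_univ _) G.maxTrianglesAtEdge fun j _ =>
      hl.card_filter_edge_le _ j fun τ _ h => .inl h.symm
  simpa using this

theorem IsStreamOf.numTriangles_le_vertices_mul :
    G.numTriangles 1 ≤ n * min G.maxTrianglesAtVertex G.numEdges := by
  rw [← hl.card_wedges, mul_comm]
  have := Finset.card_le_mul_card_image_of_maps_to (s := wedges l) (t := Finset.univ)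
    (f := wedgeApex) (fun _ _ => Finset.mem_univ _) _ fun x _ => hl.card_wedges_apex_le x
  simpa using this

end Stream

/-- Every signed graph has a stream. -/
theorem SignedGraph.exists_isStreamOf (G : SignedGraph n) :
    ∃ l : List (SignedEdge n), IsStreamOf l G := by
  classical
  let f : Sym2 (Fin n) → SignedEdge n := fun e => ⟨e.out.1, e.out.2, G.sign e⟩
  have hf : ∀ e, (f e).edge = e := fun e => by
    simp only [f, SignedEdge.edge]
    exact Quot.out_eq e
  have hmap : (G.graph.edgeFinset.toList.map f).map SignedEdge.edge =
      G.graph.edgeFinset.toList := by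
    rw [List.map_map]
    conv_rhs => rw [← List.map_id G.graph.edgeFinset.toList]
    exact List.map_congr_left fun e _ => hf e
  refine ⟨G.graph.edgeFinset.toList.map f, ?_, ?_, ?_⟩
  · rw [hmap]; exact Finset.nodup_toList _
  · intro e; rw [hmap]; simp
  · intro a ha
    obtain ⟨e, -, rfl⟩ := List.mem_map.1 ha
    rw [hf]

/-! ### The state of a group -/

/-- The memory of a group after the positions `is` of `l`. -/
noncomputable def groupFold (θ : Params n) (l : List (SignedEdge n))
    (k : Fin θ.numMean → Fin θ.numSeeds) (c : Fin l.length → Fin θ.numMean → Bool)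
    (is : List (Fin l.length)) : GroupMem θ :=
  is.foldl (fun M i => groupStep M (l.get i) (c i)) (some fun j => estInit θ (k j))

/-- The number of stored edges never decreases, so checking the budget at every step is the same as
checking it once at the end. -/
theorem groupFold_eq (θ : Params n) (l : List (SignedEdge n)) (k c is) :
    groupFold θ l k c is =
      if ∑ j, (runFold θ l (k j) (fun i => c i j) is).numStored ≤ θ.budget then
        some fun j => runFold θ l (k j) (fun i => c i j) is else none := by
  induction is using List.reverseRecOn with
  | nil => simp [groupFold, runFold_nil, numStored_estInit]
  | append_singleton is i ih =>
    have h : groupFold θ l k c (is ++ [i]) =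
        groupStep (groupFold θ l k c is) (l.get i) (c i) := by simp [groupFold]
    rw [h, ih]
    simp only [runFold_concat]
    split_ifs with h1 h2 h2
    · simp only [groupStep]
      rw [if_pos h2]
    · simp only [groupStep]
      rw [if_neg h2]
    · exact absurd ((Finset.sum_le_sum fun j _ => numStored_le_estStep _ _ _).trans h2) h1
    · rfl

theorem medianOfMeans_run (θ : Params n) (l : List (SignedEdge n)) (s c) :
    (medianOfMeans θ).run l s c =
      fun g => groupFold θ l (s g) (fun i => c i g) (List.finRange l.length) := by
  unfold StreamAlg.run
  generalize List.finRange l.length = is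
  induction is using List.reverseRecOn with
  | nil => rfl
  | append_singleton is i ih =>
    rw [List.foldl_append, ih]
    funext g
    simp [groupFold, medianOfMeans]

/-! ### Independence of the runs -/

/-- The seeds and bits of the runs, sorted by run. -/
def sortByRun {k N M L : ℕ}
    (ω : (Fin k → Fin N → Fin M) × (Fin L → Fin k → Fin N → Bool)) :
    Fin k → Fin N → Fin M × (Fin L → Bool) :=
  fun g j => (ω.1 g j, fun i => ω.2 i g j)

instance (θ : Params n) : IsProbabilityMeasure (coinLaw θ) := by
  unfold coinLaw; infer_instance

instance (θ : Params n) : IsProbabilityMeasure (seedLaw θ) := by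
  unfold seedLaw; infer_instance

/-- Draws are made per arrival, while the analysis needs independent runs. On these finite spaces it
suffices to compare singletons, where both sides are the same product in a different order. -/
theorem map_sortByRun (θ : Params n) (L : ℕ) :
    ((seedLaw θ).prod (Measure.pi fun _ : Fin L => coinLaw θ)).map sortByRun =
      Measure.pi fun _ => Measure.pi fun _ => runLaw θ L := by
  refine Measure.ext_of_singleton fun y => ?_
  rw [Measure.map_apply (measurable_of_countable _) (measurableSet_singleton _)]
  have : sortByRun ⁻¹' {y} = {(fun g j => (y g j).1 : Fin θ.numGroups → Fin θ.numMean →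
      Fin θ.numSeeds)} ×ˢ {fun i g j => (y g j).2 i} := by
    ext ω
    simp only [Set.mem_preimage, Set.mem_singleton_iff, Set.mem_prod]
    constructor
    · rintro rfl
      exact ⟨rfl, rfl⟩
    · rintro ⟨h1, h2⟩
      funext g j
      simp [sortByRun, h1, h2]
  rw [this, Measure.prod_prod]
  have hrun : ∀ z : Fin θ.numSeeds × (Fin L → Bool), runLaw θ L {z} =
      ProbabilityTheory.uniformOn Set.univ {z.1} * ∏ i, bernoulliLaw θ.pE {z.2 i} := by
    intro z
    rw [← Set.singleton_prod_singleton, runLaw, Measure.prod_prod, Measure.pi_singleton]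
  simp only [seedLaw, coinLaw, Measure.pi_singleton, hrun, Finset.prod_mul_distrib]
  congr 1
  rw [Finset.prod_comm]
  exact Finset.prod_congr rfl fun g _ => Finset.prod_comm

/-! ### Success of one group -/

/-- The estimate of a run, in terms of its random draws. -/
noncomputable def runEstimate (θ : Params n) (l : List (SignedEdge n))
    (ω : Fin θ.numSeeds × (Fin l.length → Bool)) : ℝ :=
  (runFold θ l ω.1 ω.2 (List.finRange l.length)).R

/-- The number of edges stored by a run, in terms of its random draws. -/
noncomputable def runStored (θ : Params n) (l : List (SignedEdge n))
    (ω : Fin θ.numSeeds × (Fin l.length → Bool)) : ℕ :=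
  (runFold θ l ω.1 ω.2 (List.finRange l.length)).numStored

/-- The contribution of a group to the median, in terms of its random draws. -/
noncomputable def groupOutput (θ : Params n) (l : List (SignedEdge n))
    (y : Fin θ.numMean → Fin θ.numSeeds × (Fin l.length → Bool)) : ℝ :=
  groupMean (groupFold θ l (fun j => (y j).1) (fun i j => (y j).2 i) (List.finRange l.length))

theorem groupOutput_eq (θ : Params n) (l : List (SignedEdge n)) (y) :
    groupOutput θ l y = if ∑ j, runStored θ l (y j) ≤ θ.budget then
      (∑ j, runEstimate θ l (y j)) / θ.numMean else 0 := by
  rw [groupOutput, groupFold_eq]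
  unfold runStored
  split_ifs with h
  · rfl
  · rfl

section Stream

variable {l : List (SignedEdge n)} {G : SignedGraph n} (hl : IsStreamOf l G)
include hl

theorem runEstimate_eq (θ : Params n) : runEstimate θ l =
    fun ω => sampledCount θ (wedges l) wedgeApex wedgeLegs ω * (1 / (θ.pV * θ.pE ^ 2)) := by
  funext ω
  exact runFold_finRange_R hl.injective θ ω.1 ω.2

theorem integral_runEstimate (θ : Params n) :
    ∫ ω, runEstimate θ l ω ∂runLaw θ l.length = G.numTriangles 1 := by
  have hV := θ.pV_pos
  have hE := θ.pE_pos
  rw [runEstimate_eq hl, integral_mul_const,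
    integral_sampledCount θ _ _ _ fun τ hτ => hl.card_wedgeLegs hτ, hl.card_wedges]
  field_simp

theorem variance_runEstimate_le (θ : Params n) :
    ProbabilityTheory.variance (runEstimate θ l) (runLaw θ l.length) ≤
      G.numTriangles 1 * (min G.maxTrianglesAtVertex G.numEdges / θ.pV +
        2 * G.maxTrianglesAtEdge / (θ.pV * θ.pE) + 1 / (θ.pV * θ.pE ^ 2)) := by
  have hV := θ.pV_pos
  have hE := θ.pE_pos
  rw [runEstimate_eq hl, ProbabilityTheory.variance_mul_const]
  have h := variance_sampledCount_le θ (wedges l) wedgeApex wedgeLegs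
    (fun τ hτ => hl.card_wedgeLegs hτ) hl.injOn_wedgeLegs hl.card_wedges_apex_le
    hl.card_wedges_leg_le
  rw [hl.card_wedges] at h
  refine (mul_le_mul_of_nonneg_right h (sq_nonneg _)).trans (le_of_eq ?_)
  push_cast
  field_simp

/-- Each arriving edge is stored only if its bit is `1` and one of its two endpoints is sampled; a
union bound over the endpoints gives the factor 2. -/
theorem integral_runStored_le (θ : Params n) :
    ∫ ω, (runStored θ l ω : ℝ) ∂runLaw θ l.length ≤ G.numEdges * (2 * (θ.pV * θ.pE)) := by
  classical
  calc ∫ ω, (runStored θ l ω : ℝ) ∂runLaw θ l.length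
      ≤ ∫ ω, ∑ i : Fin l.length,
          ((sampled θ (l.get i).v {i}).indicator (fun _ => (1 : ℝ)) ω +
            (sampled θ (l.get i).w {i}).indicator (fun _ => (1 : ℝ)) ω) ∂runLaw θ l.length := by
        refine integral_mono Integrable.of_finite Integrable.of_finite fun ω => ?_
        have h := numStored_runFold_le hl.injective θ ω.1 ω.2 (List.finRange l.length)
        rw [Finset.card_filter] at h
        refine (Nat.cast_le.2 h).trans ?_
        push_cast
        refine Finset.sum_le_sum fun i _ => ?_
        simp only [Set.indicator_apply, sampled, Set.mem_ofPred_eq, Finset.mem_singleton,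
          forall_eq]
        by_cases h1 : ω.2 i = true <;> by_cases h2 : θ.hV ω.1 (l.get i).v = true <;>
          by_cases h3 : θ.hV ω.1 (l.get i).w = true <;> simp [-List.get_eq_getElem, h1, h2, h3]
    _ = ∑ i : Fin l.length, (2 * (θ.pV * θ.pE)) := by
        rw [integral_finsetSum _ fun i _ => Integrable.of_finite]
        refine Finset.sum_congr rfl fun i _ => ?_
        rw [integral_add Integrable.of_finite Integrable.of_finite]
        have hI : ∀ u, ∫ ω, (sampled θ u {i}).indicator (fun _ => (1 : ℝ)) ω ∂runLaw θ l.length =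
            θ.pV * θ.pE := fun u => by
          have := integral_indicator_one (μ := runLaw θ l.length) (s := sampled θ u {i})
            (Set.toFinite _).measurableSet
          rw [runLaw_real_sampled, Finset.card_singleton, pow_one] at this
          exact this
        rw [hI, hI]
        ring
    _ = _ := by simp [hl.length_eq]

/-- Markov's inequality: the expected total is at most `2 * N * m * pV * pE`, and exceeding an
integer budget means reaching `budget + 1`, which is at least 32 times as large. -/
theorem measure_overBudget_le (θ : Params n)
    (hbud : 64 * (θ.numMean * (G.numEdges * (θ.pV * θ.pE))) ≤ θ.budget + 1) :
    Measure.pi (fun _ : Fin θ.numMean => runLaw θ l.length)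
      {y | θ.budget < ∑ j, runStored θ l (y j)} ≤ ENNReal.ofReal (1 / 32) := by
  set P := Measure.pi (fun _ : Fin θ.numMean => runLaw θ l.length)
  have hint : ∫ y, (∑ j, (runStored θ l (y j) : ℝ)) ∂P ≤
      θ.numMean * (G.numEdges * (2 * (θ.pV * θ.pE))) := by
    rw [integral_finsetSum _ fun i _ => Integrable.of_finite, ← nsmul_eq_mul]
    refine (Finset.sum_le_card_nsmul _ _ (G.numEdges * (2 * (θ.pV * θ.pE))) fun j _ => ?_).trans
      (by simp)
    rw [integral_comp_eval (μ := fun _ : Fin θ.numMean => runLaw θ l.length) (i := j)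
      (f := fun ω => (runStored θ l ω : ℝ)) (by fun_prop)]
    exact integral_runStored_le hl θ
  have hm := mul_meas_ge_le_integral_of_nonneg (μ := P)
    (f := fun y => ∑ j, (runStored θ l (y j) : ℝ))
    (Filter.Eventually.of_forall fun y => by positivity) Integrable.of_finite (θ.budget + 1)
  have hset : {y : Fin θ.numMean → Fin θ.numSeeds × (Fin l.length → Bool) |
      θ.budget < ∑ j, runStored θ l (y j)} =
      {y | (θ.budget + 1 : ℝ) ≤ ∑ j, (runStored θ l (y j) : ℝ)} := by
    ext y
    simp only [Set.mem_ofPred_eq]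
    rw [← Nat.succ_le_iff]
    exact_mod_cast Iff.rfl
  rw [hset, ← ofReal_measureReal]
  refine ENNReal.ofReal_le_ofReal ?_
  have hb : (0 : ℝ) < θ.budget + 1 := by positivity
  by_contra! hc
  nlinarith

theorem measure_mean_far_le (θ : Params n) {ε : ℝ} (hε : 0 < ε) (hT : 0 < G.numTriangles 1)
    (hvar : 32 * ProbabilityTheory.variance (runEstimate θ l) (runLaw θ l.length) ≤
      θ.numMean * (ε * G.numTriangles 1) ^ 2) :
    Measure.pi (fun _ : Fin θ.numMean => runLaw θ l.length)
      {y | ε * G.numTriangles 1 ≤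
        |(∑ j, runEstimate θ l (y j)) / θ.numMean - G.numTriangles 1|} ≤
      ENNReal.ofReal (1 / 32) := by
  have hN : (0 : ℝ) < θ.numMean := Nat.cast_pos.2 θ.numMean_pos
  have hT' : (0 : ℝ) < G.numTriangles 1 := Nat.cast_pos.2 hT
  set P := Measure.pi (fun _ : Fin θ.numMean => runLaw θ l.length) with hP
  have hmean : ∫ y, (∑ j, runEstimate θ l (y j)) / θ.numMean ∂P = G.numTriangles 1 := by
    rw [integral_div, integral_finsetSum _ fun i _ => Integrable.of_finite]
    have : ∀ j : Fin θ.numMean, ∫ y, runEstimate θ l (y j) ∂P = G.numTriangles 1 := fun j => by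
      rw [hP, integral_comp_eval (μ := fun _ : Fin θ.numMean => runLaw θ l.length) (i := j)
        (f := runEstimate θ l) (by fun_prop)]
      exact integral_runEstimate hl θ
    simp only [this, Finset.sum_const, Finset.card_univ, Fintype.card_fin, nsmul_eq_mul]
    field_simp
  have hv : ProbabilityTheory.variance (fun y => (∑ j, runEstimate θ l (y j)) / θ.numMean) P =
      ProbabilityTheory.variance (runEstimate θ l) (runLaw θ l.length) / θ.numMean := by
    simp only [div_eq_mul_inv]
    rw [ProbabilityTheory.variance_mul_const]
    have := ProbabilityTheory.variance_sum_pi (μ := fun _ : Fin θ.numMean => runLaw θ l.length)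
      (X := fun _ => runEstimate θ l) fun _ => .of_discrete
    have h2 : (∑ i : Fin θ.numMean, fun ω : Fin θ.numMean → Fin θ.numSeeds × (Fin l.length → Bool)
        => runEstimate θ l (ω i)) = fun y => ∑ j, runEstimate θ l (y j) := by
      funext y; simp
    rw [h2] at this
    rw [this]
    simp only [Finset.sum_const, Finset.card_univ, Fintype.card_fin, nsmul_eq_mul]
    field_simp
  have hc : 0 < ε * G.numTriangles 1 := mul_pos hε hT'
  have h := ProbabilityTheory.meas_ge_le_variance_div_sq (μ := P)
    (X := fun y => (∑ j, runEstimate θ l (y j)) / θ.numMean) .of_discrete hc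
  rw [hmean, hv] at h
  refine h.trans (ENNReal.ofReal_le_ofReal ?_)
  rw [div_div, div_le_div_iff₀ (by positivity) (by norm_num)]
  linarith

theorem measure_group_bad_le (θ : Params n) {ε : ℝ} (hε : 0 < ε) (hT : 0 < G.numTriangles 1)
    (hvar : 32 * ProbabilityTheory.variance (runEstimate θ l) (runLaw θ l.length) ≤
      θ.numMean * (ε * G.numTriangles 1) ^ 2)
    (hbud : 64 * (θ.numMean * (G.numEdges * (θ.pV * θ.pE))) ≤ θ.budget + 1) :
    Measure.pi (fun _ : Fin θ.numMean => runLaw θ l.length)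
      {y | ε * G.numTriangles 1 < |groupOutput θ l y - G.numTriangles 1|} ≤
      ENNReal.ofReal (1 / 16) := by
  refine (measure_mono (t := {y | θ.budget < ∑ j, runStored θ l (y j)} ∪ {y | ε * G.numTriangles 1 ≤
        |(∑ j, runEstimate θ l (y j)) / θ.numMean - G.numTriangles 1|}) ?_).trans ?_
  · intro y hy
    rw [Set.mem_ofPred_eq, groupOutput_eq] at hy
    by_cases h : ∑ j, runStored θ l (y j) ≤ θ.budget
    · rw [if_pos h] at hy
      exact .inr hy.le
    · exact .inl (not_le.1 h)
  · refine (measure_union_le _ _).trans ((add_le_add (measure_overBudget_le hl θ hbud)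
      (measure_mean_far_le hl θ hε hT hvar)).trans ?_)
    rw [← ENNReal.ofReal_add (by norm_num) (by norm_num)]
    norm_num

theorem outProb_ge (θ : Params n) {ε : ℝ} (hε : 0 < ε) (hT : 0 < G.numTriangles 1)
    (hvar : 32 * ProbabilityTheory.variance (runEstimate θ l) (runLaw θ l.length) ≤
      θ.numMean * (ε * G.numTriangles 1) ^ 2)
    (hbud : 64 * (θ.numMean * (G.numEdges * (θ.pV * θ.pE))) ≤ θ.budget + 1) :
    ENNReal.ofReal (1 - (1 / 2) ^ θ.numGroups) ≤
      (medianOfMeans θ).outProb (seedLaw θ) (coinLaw θ) l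
        {R | |R - (G.numTriangles 1 : ℝ)| ≤ ε * (G.numTriangles 1 : ℝ)} := by
  set T : ℝ := (G.numTriangles 1 : ℝ)
  set Bad := {y | ε * T < |groupOutput θ l y - T|} with hBad
  set Q := Measure.pi fun _ : Fin θ.numGroups =>
    Measure.pi fun _ : Fin θ.numMean => runLaw θ l.length with hQ
  have hhalf := measure_half_bad_le (Measure.pi fun _ : Fin θ.numMean => runLaw θ l.length)
    θ.numGroups (measure_group_bad_le hl θ hε hT hvar hbud)
  rw [← hQ, ← hBad] at hhalf
  have hout : (medianOfMeans θ).outProb (seedLaw θ) (coinLaw θ) l {R | |R - T| ≤ ε * T} =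
      Q {y | |median (fun g => groupOutput θ l (y g)) - T| ≤ ε * T} := by
    rw [hQ, ← map_sortByRun, Measure.map_apply (measurable_of_countable _)
      (Set.toFinite _).measurableSet, StreamAlg.outProb]
    simp only [medianOfMeans_run]
    rfl
  rw [hout]
  -- By `median_mem_Icc`, a wrong median forces at least half of the groups to be bad.
  have hsub : {y : Fin θ.numGroups → Fin θ.numMean → Fin θ.numSeeds × (Fin l.length → Bool) |
      |median (fun g => groupOutput θ l (y g)) - T| ≤ ε * T}ᶜ ⊆
      {ω | ∃ I : Finset (Fin θ.numGroups), θ.numGroups ≤ 2 * I.card ∧ ∀ g ∈ I, ω g ∈ Bad} := by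
    classical
    intro y hy
    by_contra hno
    refine hy ?_
    have hiff : ∀ x : ℝ, |x - T| ≤ ε * T ↔ x ∈ Set.Icc (T - ε * T) (T + ε * T) := fun x => by
      rw [abs_le, Set.mem_Icc]
      constructor <;> rintro ⟨h1, h2⟩ <;> constructor <;> linarith
    refine (hiff _).2 (median_mem_Icc _ ?_)
    by_contra! hcard
    refine hno ⟨_, hcard, fun g hg => ?_⟩
    rw [Finset.mem_filter, ← hiff, not_le] at hg
    exact hg.2
  have hle := (measure_mono hsub).trans hhalf
  have h1 : (1 : ENNReal) ≤ Q {y | |median (fun g => groupOutput θ l (y g)) - T| ≤ ε * T} +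
      Q {y | |median (fun g => groupOutput θ l (y g)) - T| ≤ ε * T}ᶜ := by
    rw [measure_add_measure_compl (Set.toFinite _).measurableSet, measure_univ]
  rw [ENNReal.ofReal_sub _ (by positivity), ENNReal.ofReal_one]
  exact tsub_le_iff_right.2 (h1.trans (by gcongr))

end Stream

/-! ### Counting the memory states -/

theorem card_sym2_fin_le (n : ℕ) : Fintype.card (Sym2 (Fin n)) ≤ n ^ 2 := by
  have := Fintype.card_le_of_surjective (fun p : Fin n × Fin n => s(p.1, p.2)) fun e => by
    induction e using Sym2.ind with
    | _ x y => exact ⟨(x, y), rfl⟩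
  simpa [sq] using this

open Classical in
/-- Families of `N` dictionaries with at most `B` entries in total. -/
abbrev Dictionaries (n N B : ℕ) : Type :=
  {f : Fin N → Sym2 (Fin n) → Option ℤˣ // ∑ j, {e | f j e ≠ none}.ncard ≤ B}

-- A generating function in the number of stored entries: each slot is empty with weight 1 or holds
-- one of two signs with weight `x`, hence the factor `1 + 2 * x`.
open Classical in
theorem sum_prod_dictionary (n N : ℕ) (x : ℝ) :
    ∑ f : Fin N → Sym2 (Fin n) → Option ℤˣ, x ^ (∑ j, {e | f j e ≠ none}.ncard) =
      ((1 + 2 * x) ^ Fintype.card (Sym2 (Fin n))) ^ N := by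
  have h1 : ∀ d : Sym2 (Fin n) → Option ℤˣ,
      x ^ {e | d e ≠ none}.ncard = ∏ e, if d e = none then 1 else x := by
    intro d
    rw [Finset.prod_ite, Finset.prod_const_one, one_mul, Finset.prod_const,
      Set.ncard_eq_toFinset_card']
    congr 2
    ext e
    simp
  have h2 : ∑ d : Sym2 (Fin n) → Option ℤˣ, x ^ {e | d e ≠ none}.ncard =
      (1 + 2 * x) ^ Fintype.card (Sym2 (Fin n)) := by
    simp only [h1]
    rw [← Fintype.piFinset_univ, ← Finset.prod_univ_sum (fun _ => Finset.univ)
      fun (_ : Sym2 (Fin n)) (o : Option ℤˣ) => if o = none then 1 else x]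
    simp [Fintype.sum_option]
  simp only [← Finset.prod_pow_eq_pow_sum]
  rw [← Fintype.piFinset_univ, ← Finset.prod_univ_sum (fun _ => Finset.univ)
      fun (_ : Fin N) (d : Sym2 (Fin n) → Option ℤˣ) => x ^ {e | d e ≠ none}.ncard]
  simp [h2]

-- Evaluating the generating function at `x = 1 / (2 n²)` bounds each factor by `exp 1`, so the
-- family has total weight at most `4 ^ N`, while each admissible member weighs at least `x ^ B`.
-- Joint counting makes the exponents add as `B log n + N`; a budget of `B` for every run would
-- multiply them.
open Classical in
theorem card_dictionaries_le {n : ℕ} (hn : 0 < n) (N B : ℕ) :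
    Fintype.card (Dictionaries n N B) ≤ (2 * n ^ 2) ^ B * 4 ^ N := by
  set x : ℝ := 1 / (2 * n ^ 2) with hx
  have hn1 : (1 : ℝ) ≤ n := by exact_mod_cast hn
  have hx0 : 0 < x := by positivity
  have hx1 : x ≤ 1 := by
    rw [hx, div_le_one (by positivity)]
    nlinarith
  have hpow : (1 + 2 * x) ^ Fintype.card (Sym2 (Fin n)) ≤ 4 := by
    calc (1 + 2 * x) ^ Fintype.card (Sym2 (Fin n)) ≤ (1 + 2 * x) ^ (n ^ 2) :=
          pow_le_pow_right₀ (by linarith) (card_sym2_fin_le n)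
      _ ≤ (Real.exp (2 * x)) ^ (n ^ 2) := by
          gcongr
          linarith [Real.add_one_le_exp (2 * x)]
      _ = Real.exp 1 := by
          rw [← Real.exp_nat_mul, hx]
          congr 1
          push_cast
          field_simp
      _ ≤ 4 := by linarith [Real.exp_one_lt_d9]
  have hsum : (Fintype.card (Dictionaries n N B) : ℝ) * x ^ B ≤ 4 ^ N := by
    calc (Fintype.card (Dictionaries n N B) : ℝ) * x ^ B
        = ∑ _f : Dictionaries n N B, x ^ B := by simp
      _ ≤ ∑ f : Dictionaries n N B, x ^ (∑ j, {e | f.1 j e ≠ none}.ncard) :=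
          Finset.sum_le_sum fun f _ => pow_le_pow_of_le_one hx0.le hx1 f.2
      _ = ∑ f ∈ Finset.univ.filter fun f : Fin N → Sym2 (Fin n) → Option ℤˣ =>
            ∑ j, {e | f j e ≠ none}.ncard ≤ B, x ^ (∑ j, {e | f j e ≠ none}.ncard) :=
          (Finset.sum_subtype (p := fun f => ∑ j, {e | f j e ≠ none}.ncard ≤ B) _
            (fun f => by rw [Finset.mem_filter]; simp)
            fun f : Fin N → Sym2 (Fin n) → Option ℤˣ => x ^ (∑ j, {e | f j e ≠ none}.ncard)).symm
      _ ≤ ∑ f : Fin N → Sym2 (Fin n) → Option ℤˣ, x ^ (∑ j, {e | f j e ≠ none}.ncard) :=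
          Finset.sum_le_sum_of_subset_of_nonneg (Finset.filter_subset _ _)
            fun _ _ _ => by positivity
      _ = ((1 + 2 * x) ^ Fintype.card (Sym2 (Fin n))) ^ N := sum_prod_dictionary n N x
      _ ≤ 4 ^ N := by gcongr
  rw [hx, div_pow, one_pow, mul_one_div, div_le_iff₀ (by positivity)] at hsum
  rw [mul_comm]
  exact_mod_cast hsum

/-- If the reachable memory contents are indexed by a type with at most `2ᵇ` elements, `b` bits
are enough. -/
theorem StreamAlg.usesAtMostBits_of_card_le {α Seed Coin Mem X : Type} [Fintype X]
    (A : StreamAlg α Seed Coin Mem) {P : Set (List α)} {b : ℕ} (p : X → Mem)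
    (hp : A.reachable P ⊆ Set.range p) (hX : Fintype.card X ≤ 2 ^ b) :
    A.UsesAtMostBits P b := by
  classical
  rcases isEmpty_or_nonempty X with hE | hE
  · refine ⟨fun _ _ => false, fun M hM => ?_⟩
    obtain ⟨x, -⟩ := hp hM
    exact hE.elim x
  obtain ⟨e⟩ := Function.Embedding.nonempty_of_card_le (α := X) (β := Fin b → Bool) (by simpa)
  refine ⟨fun M => e (Function.invFun p M), fun M hM M' hM' h => ?_⟩
  rw [← Function.invFun_eq (hp hM), ← Function.invFun_eq (hp hM'), e.injective h]

/-- Although `R` is a real number, it is a bounded integer multiple of a fixed constant, so it can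
be stored as a counter. -/
theorem runFold_R_eq (θ : Params n) (l : List (SignedEdge n)) (k c is) :
    ∃ r : ℕ, r ≤ is.length * n ∧
      (runFold θ l k c is).R = r * (1 / (θ.pV * θ.pE ^ 2)) := by
  induction is using List.reverseRecOn with
  | nil => exact ⟨0, by simp, by simp [runFold_nil, estInit]⟩
  | append_singleton is i ih =>
    obtain ⟨r, hr, hR⟩ := ih
    refine ⟨r + (detected (runFold θ l k c is) (l.get i)).ncard, ?_, ?_⟩
    · have : (detected (runFold θ l k c is) (l.get i)).ncard ≤ n := by
        simpa using Set.ncard_le_card (detected (runFold θ l k c is) (l.get i))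
      rw [List.length_append, List.length_singleton, add_mul, one_mul]
      omega
    · rw [runFold_concat, Nat.cast_add, add_mul, ← hR]
      rfl

theorem IsStreamOf.length_le {l : List (SignedEdge n)} {G : SignedGraph n}
    (hl : IsStreamOf l G) : l.length ≤ n ^ 2 := by
  have := (List.Nodup.length_le_card hl.1).trans (card_sym2_fin_le n)
  simpa using this

/-- The memory of a group that is given by hash indices, counts of detections and dictionaries. -/
noncomputable def decodeGroup (θ : Params n) {K : ℕ} :
    Option ((Fin θ.numMean → Fin θ.numSeeds) × (Fin θ.numMean → Fin K) ×
      Dictionaries n θ.numMean θ.budget) → GroupMem θ :=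
  Option.map fun x j => ⟨x.1 j, (x.2.1 j : ℕ) * (1 / (θ.pV * θ.pE ^ 2)), x.2.2.1 j⟩

theorem usesAtMostBits_medianOfMeans (θ : Params n) (hn : 0 < n) (S : Set (SignedGraph n)) {a : ℕ}
    (ha : n ≤ 2 ^ a) (hseeds : θ.numSeeds ≤ 2 ^ (2 * a + 2)) :
    (medianOfMeans θ).UsesAtMostBits {l | ∃ G ∈ S, IsStreamOf l G}
      (θ.numGroups * ((θ.numMean + θ.budget) * (5 * a + 6))) := by
  classical
  refine StreamAlg.usesAtMostBits_of_card_le _ (X := Fin θ.numGroups →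
    Option ((Fin θ.numMean → Fin θ.numSeeds) × (Fin θ.numMean → Fin (n ^ 3 + 1)) ×
      Dictionaries n θ.numMean θ.budget)) (fun x g => decodeGroup θ (x g)) ?_ ?_
  -- An intermediate memory is the final memory of a prefix `l'`, which has at most `n ^ 2` items;
  -- the counters therefore stay at most `n ^ 3`.
  · rintro M ⟨l, ⟨G, -, hl⟩, l', hpre, s, c, rfl⟩
    have hlen : l'.length ≤ n ^ 2 := hpre.length_le.trans hl.length_le
    rw [medianOfMeans_run]
    have hg : ∀ g, ∃ x, decodeGroup θ (K := n ^ 3 + 1) x = groupFold θ l' (s g) (fun i => c i g)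
        (List.finRange l'.length) := by
      intro g
      rw [groupFold_eq]
      split_ifs with h
      · have hr := fun j => runFold_R_eq θ l' (s g j) (fun i => c i g j) (List.finRange l'.length)
        choose r hr hR using hr
        have hr' : ∀ j, r j < n ^ 3 + 1 := fun j => by
          have h1 := hr j
          rw [List.length_finRange] at h1
          have h2 : l'.length * n ≤ n ^ 2 * n := Nat.mul_le_mul_right n hlen
          have h3 : n ^ 3 = n ^ 2 * n := pow_succ n 2
          omega
        refine ⟨some (s g, fun j => ⟨r j, hr' j⟩, ⟨fun j => (runFold θ l' (s g j)
          (fun i => c i g j) (List.finRange l'.length)).S, h⟩), ?_⟩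
        simp only [decodeGroup, Option.map_some]
        congr 1
        funext j
        rw [← hR]
        exact congrArg (fun k => EstMem.mk k _ _) (runFold_seed θ l' _ _ _).symm
      · exact ⟨none, rfl⟩
    choose x hx using hg
    exact ⟨x, funext hx⟩
  · have hD : Fintype.card (Dictionaries n θ.numMean θ.budget) ≤
        2 ^ ((2 * a + 1) * θ.budget + 2 * θ.numMean) := by
      refine (card_dictionaries_le hn _ _).trans ?_
      rw [pow_add, pow_mul, pow_mul]
      gcongr
      · rw [pow_add, pow_mul', pow_one, mul_comm]
        gcongr
      · norm_num
    have hK : n ^ 3 + 1 ≤ 2 ^ (3 * a + 1) := by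
      have h1 : n ^ 3 ≤ 2 ^ (3 * a) := by
        rw [pow_mul']
        gcongr
      have := Nat.one_le_two_pow (n := 3 * a)
      have h2 : 2 ^ (3 * a + 1) = 2 ^ (3 * a) * 2 := pow_succ 2 _
      omega
    have hcard : Fintype.card ((Fin θ.numMean → Fin θ.numSeeds) ×
        (Fin θ.numMean → Fin (n ^ 3 + 1)) × Dictionaries n θ.numMean θ.budget) ≤
        2 ^ (θ.numMean * (5 * a + 5) + (2 * a + 1) * θ.budget) := by
      simp only [Fintype.card_prod, Fintype.card_fun, Fintype.card_fin]
      calc θ.numSeeds ^ θ.numMean * ((n ^ 3 + 1) ^ θ.numMean *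
            Fintype.card (Dictionaries n θ.numMean θ.budget))
          ≤ (2 ^ (2 * a + 2)) ^ θ.numMean * ((2 ^ (3 * a + 1)) ^ θ.numMean *
            2 ^ ((2 * a + 1) * θ.budget + 2 * θ.numMean)) := by gcongr
        _ = _ := by
          rw [← pow_mul, ← pow_mul, ← pow_add, ← pow_add]
          congr 1
          ring
    rw [Fintype.card_fun, Fintype.card_fin, mul_comm, pow_mul]
    refine Nat.pow_le_pow_left ?_ _
    rw [Fintype.card_option]
    have hpos := θ.numMean_pos
    have h1 := Nat.one_le_two_pow (n := θ.numMean * (5 * a + 5) + (2 * a + 1) * θ.budget)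
    -- The extra bit accounts for the abandoned state `none`; it is absorbed because `numMean` is
    -- positive.
    calc _ ≤ 2 ^ (θ.numMean * (5 * a + 5) + (2 * a + 1) * θ.budget + 1) := by
          rw [pow_succ 2 (_ + _)]
          omega
      _ ≤ _ := by
          refine Nat.pow_le_pow_right (by norm_num) ?_
          nlinarith [Nat.zero_le (a * θ.budget)]

/-! ### Choice of the parameters -/

theorem three_le_of_numTriangles_pos {G : SignedGraph n} (h : 0 < G.numTriangles 1) : 3 ≤ n := by
  obtain ⟨t, ht, -⟩ := (Set.ncard_pos (Set.toFinite _)).1 h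
  have hcl : G.graph.IsNClique 3 t := ht
  simpa [hcl.card_eq] using Finset.card_le_univ t

/-- A number `k / q` for the vertex sampling probability and a number `N` of runs whose product is
`Q` up to a factor of two. -/
theorem exists_sampling_rate {Q : ℝ} {q : ℕ} (hq : 0 < q) (hQ : 1 / q ≤ Q) :
    ∃ k N : ℕ, 0 < k ∧ k ≤ q ∧ 0 < N ∧ (N : ℝ) ≤ Q + 1 ∧
      Q ≤ N * (k / q : ℝ) ∧ N * (k / q : ℝ) ≤ 2 * Q := by
  have hq' : (0 : ℝ) < q := Nat.cast_pos.2 hq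
  have hQ0 : 0 < Q := (by positivity : (0 : ℝ) < 1 / q).trans_le hQ
  rcases le_or_gt Q 1 with h | h
  -- A single run with `Q` rounded up to a multiple of `1 / q`; the rounding at most doubles it
  -- because `1 / q ≤ Q`. For `Q > 1` every vertex is sampled instead and only the number of runs
  -- grows.
  · refine ⟨⌈Q * q⌉₊, 1, Nat.ceil_pos.2 (by positivity), ?_, one_pos, by simpa using hQ0.le,
      ?_, ?_⟩
    · rw [Nat.ceil_le]
      nlinarith
    · rw [Nat.cast_one, one_mul, le_div_iff₀ hq']
      exact Nat.le_ceil _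
    · rw [Nat.cast_one, one_mul, div_le_iff₀ hq']
      have := (Nat.ceil_lt_add_one (by positivity : 0 ≤ Q * q)).le
      rw [div_le_iff₀ hq'] at hQ
      linarith
  · refine ⟨q, ⌈Q⌉₊, hq, le_rfl, Nat.ceil_pos.2 hQ0, (Nat.ceil_lt_add_one hQ0.le).le, ?_, ?_⟩
    · rw [div_self hq'.ne', mul_one]
      exact Nat.le_ceil _
    · rw [div_self hq'.ne', mul_one]
      linarith [Nat.ceil_lt_add_one hQ0.le]

theorem exists_numGroups {δ : ℝ} (h0 : 0 < δ) (h1 : δ ≤ 1 / 2) :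
    ∃ N : ℕ, 0 < N ∧ (N : ℝ) ≤ 3 * Real.log (1 / δ) ∧ (1 / 2 : ℝ) ^ N ≤ δ := by
  have hlog2 := Real.log_two_gt_d9
  have hlog : Real.log 2 ≤ Real.log (1 / δ) := by
    refine Real.log_le_log two_pos ?_
    rw [le_div_iff₀ h0]
    linarith
  have hpos : 0 < Real.log (1 / δ) / Real.log 2 := by
    apply div_pos <;> linarith
  refine ⟨⌈Real.log (1 / δ) / Real.log 2⌉₊, Nat.ceil_pos.2 hpos, ?_, ?_⟩
  · have hc := (Nat.ceil_lt_add_one hpos.le).le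
    have : Real.log (1 / δ) / Real.log 2 ≤ 1.5 * Real.log (1 / δ) := by
      rw [div_le_iff₀ (by linarith)]
      nlinarith
    linarith
  · have hc := Nat.le_ceil (Real.log (1 / δ) / Real.log 2)
    rw [div_le_iff₀ (by linarith)] at hc
    rw [one_div, inv_pow, inv_le_comm₀ (by positivity) h0,
      ← Real.log_le_log_iff (by positivity) (by positivity), Real.log_pow, ← one_div]
    exact hc

theorem exists_two_pow_bound (hn : 3 ≤ n) :
    ∃ a : ℕ, n ≤ 2 ^ a ∧ (5 * a + 6 : ℝ) ≤ 19 * Real.log n := by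
  refine ⟨Nat.log 2 n + 1, (Nat.lt_pow_succ_log_self one_lt_two n).le, ?_⟩
  have h3 : (3 : ℝ) ≤ n := by exact_mod_cast hn
  have hn0 : (0 : ℝ) < n := by linarith
  have h1 : 1 ≤ Real.log n := by
    rw [Real.le_log_iff_exp_le hn0]
    linarith [Real.exp_one_lt_d9]
  have h2 : (Nat.log 2 n : ℝ) * Real.log 2 ≤ Real.log n := by
    rw [← Real.log_pow]
    refine Real.log_le_log (by positivity) ?_
    exact_mod_cast Nat.pow_log_le_self 2 (by omega)
  have hlog2 := Real.log_two_gt_d9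
  have h4 : (Nat.log 2 n : ℝ) ≤ 1.5 * Real.log n := by
    nlinarith [(Nat.cast_nonneg (Nat.log 2 n) : (0 : ℝ) ≤ _)]
  push_cast
  linarith

/-- The parameters for which nothing is sampled out and nothing is stored. -/
def trivialParams (n : ℕ) : Params n where
  pV := 1
  pE := 1
  pV_pos := one_pos
  pV_le := le_rfl
  pE_pos := one_pos
  pE_le := le_rfl
  numSeeds := 1
  numSeeds_pos := one_pos
  hV := fun _ _ => true
  hV_marginal := by simp
  hV_pairwise := by simp
  numMean := 1
  numMean_pos := one_pos
  numGroups := 1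
  numGroups_pos := one_pos
  budget := 0

/-- The parameters with vertex sampling probability `k / q`, where `q` is a prime. -/
theorem exists_params {q k N M B : ℕ} {pE : ℝ} (hq : q.Prime) (hnq : n ≤ q) (hk : 0 < k)
    (hkq : k ≤ q) (hN : 0 < N) (hM : 0 < M) (hE : 0 < pE) (hE1 : pE ≤ 1) :
    ∃ θ : Params n, θ.pV = k / q ∧ θ.pE = pE ∧ θ.numSeeds = q * q ∧ θ.numMean = N ∧
      θ.numGroups = M ∧ θ.budget = B := by
  obtain ⟨hV, h1, h2⟩ := exists_pairwiseIndependent hq hnq hkq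
  have hq0 : (0 : ℝ) < q := Nat.cast_pos.2 hq.pos
  exact ⟨{
    pV := k / q
    pE := pE
    pV_pos := div_pos (Nat.cast_pos.2 hk) hq0
    pV_le := (div_le_one hq0).2 (Nat.cast_le.2 hkq)
    pE_pos := hE
    pE_le := hE1
    numSeeds := q * q
    numSeeds_pos := Nat.mul_pos hq.pos hq.pos
    hV := hV
    hV_marginal := fun u => by rw [h1 u]; push_cast; field_simp
    hV_pairwise := fun u w huw => by rw [h2 u w huw]; push_cast; field_simp
    numMean := N
    numMean_pos := hN
    numGroups := M
    numGroups_pos := hM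
    budget := B }, rfl, rfl, rfl, rfl, rfl, rfl⟩

/-- The variance condition for a group, in terms of the a priori bounds. -/
theorem variance_runEstimate_le_of_bounds (θ : Params n) {m T DE DV : ℕ} {ε s : ℝ}
    (hT : 0 < T) (hε : 0 < ε) (hs : 0 < s)
    (hsd : s ^ 2 = (min DV m : ℕ)) (hpE : θ.pE = 1 / s)
    (hQ : 64 * (s * (DE + s)) / (ε ^ 2 * T) ≤ θ.numMean * θ.pV)
    {G : SignedGraph n} (hG : G ∈ boundedGraphs n m T DE DV)
    {l : List (SignedEdge n)} (hl : IsStreamOf l G) :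
    32 * ProbabilityTheory.variance (runEstimate θ l) (runLaw θ l.length) ≤
      θ.numMean * (ε * G.numTriangles 1) ^ 2 := by
  obtain ⟨hGm, hGT, hGE, hGV⟩ := hG
  have hV := θ.pV_pos
  have hT' : (0 : ℝ) < T := Nat.cast_pos.2 hT
  have hGT' : (T : ℝ) ≤ G.numTriangles 1 := Nat.cast_le.2 hGT
  set t : ℝ := (G.numTriangles 1 : ℝ)
  have hd : (min G.maxTrianglesAtVertex G.numEdges : ℝ) ≤ s ^ 2 := by
    rw [hsd]
    exact_mod_cast min_le_min hGV hGm
  have hE : (G.maxTrianglesAtEdge : ℝ) ≤ DE := Nat.cast_le.2 hGE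
  have hvar := variance_runEstimate_le hl θ
  rw [hpE, Nat.cast_min] at hvar
  have h1 : t * ((min G.maxTrianglesAtVertex G.numEdges : ℝ) / θ.pV +
      2 * G.maxTrianglesAtEdge / (θ.pV * (1 / s)) + 1 / (θ.pV * (1 / s) ^ 2)) ≤
      t * (s ^ 2 / θ.pV + 2 * DE / (θ.pV * (1 / s)) + 1 / (θ.pV * (1 / s) ^ 2)) := by
    have : 0 < t := hT'.trans_le hGT'
    gcongr
  -- The choice `pE = 1 / s` makes the first and third terms both equal to `s ^ 2 / pV`.
  have h2 : t * (s ^ 2 / θ.pV + 2 * DE / (θ.pV * (1 / s)) + 1 / (θ.pV * (1 / s) ^ 2)) =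
      2 * (s * (DE + s)) * t / θ.pV := by
    field_simp
    ring
  have h3 : 64 * (s * (DE + s)) * t ≤ θ.numMean * θ.pV * (ε * t) ^ 2 := by
    rw [div_le_iff₀ (by positivity)] at hQ
    -- The parameters are tuned to the lower bound `T`; graphs with more triangles only relax the
    -- requirement.
    have h4 : 0 ≤ θ.numMean * θ.pV * ε ^ 2 * t * (t - T) := by
      have : 0 ≤ t - T := by linarith
      have : 0 ≤ t := hT'.le.trans hGT'
      positivity
    have := mul_le_mul_of_nonneg_right hQ (hT'.le.trans hGT')
    nlinarith
  calc _ ≤ 32 * (2 * (s * (DE + s)) * t / θ.pV) := by linarith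
    _ = 64 * (s * (DE + s)) * t / θ.pV := by ring
    _ ≤ _ := by
      rw [div_le_iff₀ hV]
      linarith

/-- One graph `G₀` satisfying the bounds makes them mutually consistent: `n ≥ 3`, `T ≤ m * DE` and
`T ≤ n * min DV m`. These inequalities absorb additive constants and keep the vertex sampling rate
at least `1 / q`. -/
theorem exists_params_of_nonempty {n m T DE DV : ℕ} {ε δ : ℝ} (hT : 0 < T) (hε : 0 < ε)
    (hε1 : ε ≤ 1) (hδ : 0 < δ) (hδ1 : δ ≤ 1 / 2)
    (hne : (boundedGraphs n m T DE DV).Nonempty) :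
    ∃ (θ : Params n) (b : ℕ),
      (b : ℝ) ≤ 1000000 * ((m : ℝ) / T * (DE + Real.sqrt DV) * Real.log n * (1 / ε ^ 2)
        * Real.log (1 / δ)) ∧
      (medianOfMeans θ).UsesAtMostBits
        {l | ∃ G ∈ boundedGraphs n m T DE DV, IsStreamOf l G} b ∧
      ∀ G ∈ boundedGraphs n m T DE DV, ∀ l : List (SignedEdge n), IsStreamOf l G →
        ENNReal.ofReal (1 - δ) ≤ (medianOfMeans θ).outProb (seedLaw θ) (coinLaw θ) l
          {R | |R - (G.numTriangles 1 : ℝ)| ≤ ε * (G.numTriangles 1 : ℝ)} := by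
  obtain ⟨G₀, hG₀m, hG₀T, hG₀E, hG₀V⟩ := hne
  obtain ⟨l₀, hl₀⟩ := G₀.exists_isStreamOf
  have hn : 3 ≤ n := three_le_of_numTriangles_pos (hT.trans_le hG₀T)
  have hTmE : T ≤ m * DE :=
    hG₀T.trans (hl₀.numTriangles_le_edges_mul.trans (Nat.mul_le_mul hG₀m hG₀E))
  have hTnd : T ≤ n * min DV m :=
    hG₀T.trans (hl₀.numTriangles_le_vertices_mul.trans
      (Nat.mul_le_mul_left n (min_le_min hG₀V hG₀m)))
  have hd1 : 1 ≤ min DV m := Nat.one_le_iff_ne_zero.2 fun h => by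
    rw [h] at hTnd
    omega
  obtain ⟨q, hq, hnq, hq2⟩ := Nat.exists_prime_lt_and_le_two_mul n (by omega)
  obtain ⟨M, hM, hM3, hMδ⟩ := exists_numGroups hδ hδ1
  obtain ⟨a, ha, ha19⟩ := exists_two_pow_bound hn
  have hT' : (0 : ℝ) < T := Nat.cast_pos.2 hT
  have hd1' : (1 : ℝ) ≤ (min DV m : ℕ) := by exact_mod_cast hd1
  set s : ℝ := Real.sqrt (min DV m : ℕ) with hs
  have hsd : s ^ 2 = (min DV m : ℕ) := Real.sq_sqrt (Nat.cast_nonneg _)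
  have hs1 : 1 ≤ s := Real.one_le_sqrt.2 hd1'
  have hsDV : s ≤ Real.sqrt DV := Real.sqrt_le_sqrt (by exact_mod_cast min_le_left _ _)
  have hsm : s ≤ m := by
    have : ((min DV m : ℕ) : ℝ) ≤ m := by exact_mod_cast min_le_right _ _
    nlinarith
  have hDE : (0 : ℝ) ≤ DE := Nat.cast_nonneg _
  have hTmE' : (T : ℝ) ≤ m * DE := by exact_mod_cast hTmE
  have hTnd' : (T : ℝ) ≤ n * s ^ 2 := by rw [hsd]; exact_mod_cast hTnd
  have hε2 : ε ^ 2 ≤ 1 := pow_le_one₀ hε.le hε1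
  have hε20 : 0 < ε ^ 2 := by positivity
  have hq0 : (0 : ℝ) < q := Nat.cast_pos.2 hq.pos
  have hnq' : (n : ℝ) ≤ q := Nat.cast_le.2 hnq.le
  set Q : ℝ := 64 * (s * (DE + s)) / (ε ^ 2 * T) with hQ
  -- From `T ≤ n * s ^ 2` and `n ≤ q`, already the `s ^ 2` part of `Q` is at least `64 / q`.
  have hqQ : 1 / q ≤ Q := by
    rw [hQ, div_le_div_iff₀ hq0 (by positivity)]
    have h1 : ε ^ 2 * T ≤ T := by nlinarith
    have h2 : (n : ℝ) * s ^ 2 ≤ q * s ^ 2 := by gcongr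
    have h3 : 0 ≤ s * DE * q := by positivity
    have h4 : 0 ≤ s ^ 2 * q := by positivity
    nlinarith
  obtain ⟨k, N, hk, hkq, hN, hNQ, hQN, hN2Q⟩ := exists_sampling_rate hq.pos hqQ
  obtain ⟨θ, hθV, hθE, hθS, hθN, hθM, hθB⟩ := exists_params (n := n) (N := N) (M := M)
    (B := ⌊64 * (N * (m * (k / q * (1 / s))))⌋₊) (pE := 1 / s) hq hnq.le hk hkq hN hM
    (by positivity) (by rw [div_le_one (by positivity)]; exact hs1)
  refine ⟨θ, θ.numGroups * ((θ.numMean + θ.budget) * (5 * a + 6)), ?_,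
    usesAtMostBits_medianOfMeans θ (by omega) _ ha ?_, fun G hG l hl => ?_⟩
  · rw [hθM, hθN, hθB]
    set Y : ℝ := m * (DE + s) / (T * ε ^ 2) with hY
    have hY1 : 1 ≤ Y := by
      rw [hY, one_le_div (by positivity)]
      have h1 : (m : ℝ) * DE ≤ m * (DE + s) := by gcongr; linarith
      nlinarith
    -- Here `s ≤ m` enters, the reason for capping `DV` by `m`. Together with `1 ≤ Y` it gives `N ≤
    -- Q + 1 ≤ 65 * Y`, so the per-run overhead fits in the bound.
    have hQY : Q ≤ 64 * Y := by
      rw [hQ, hY, ← mul_div_assoc, mul_comm (T : ℝ)]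
      gcongr
    have hB : (⌊64 * (N * (m * (k / q * (1 / s))))⌋₊ : ℝ) ≤ 8192 * Y := by
      refine (Nat.floor_le (by positivity)).trans ?_
      calc 64 * (N * (m * (k / q * (1 / s)))) = 64 * (m / s) * (N * (k / q : ℝ)) := by
            field_simp
        _ ≤ 64 * (m / s) * (2 * Q) := by gcongr
        _ = 8192 * Y := by
            rw [hQ, hY]
            field_simp
            ring
    have hX : Y ≤ (m : ℝ) / T * (DE + Real.sqrt DV) * (1 / ε ^ 2) := by
      calc Y = (m : ℝ) / T * (DE + s) * (1 / ε ^ 2) := by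
            rw [hY]
            field_simp
        _ ≤ _ := by gcongr
    have hlog : 0 ≤ Real.log n := Real.log_natCast_nonneg n
    have hlogδ : 0 ≤ Real.log (1 / δ) := by
      have : (0 : ℝ) ≤ M := Nat.cast_nonneg _
      linarith
    push_cast
    calc (M : ℝ) * ((N + ⌊64 * (N * (m * (k / q * (1 / s))))⌋₊) * (5 * a + 6))
        ≤ (3 * Real.log (1 / δ)) * ((65 * Y + 8192 * Y) * (19 * Real.log n)) := by
          gcongr
          linarith
      _ = 470649 * (Y * Real.log n * Real.log (1 / δ)) := by ring
      _ ≤ 1000000 * (Y * Real.log n * Real.log (1 / δ)) := by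
          have : 0 ≤ Y * Real.log n * Real.log (1 / δ) := by positivity
          linarith
      _ ≤ 1000000 * ((m : ℝ) / T * (DE + Real.sqrt DV) * (1 / ε ^ 2) * Real.log n *
            Real.log (1 / δ)) := by gcongr
      _ = _ := by ring
  · rw [hθS]
    calc q * q ≤ (2 * 2 ^ a) * (2 * 2 ^ a) := by
          have : q ≤ 2 * 2 ^ a := hq2.trans (by omega)
          gcongr
      _ = 2 ^ (2 * a + 2) := by ring
  · refine le_trans (ENNReal.ofReal_le_ofReal ?_)
      (outProb_ge hl θ hε (hT.trans_le hG.2.1)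
        (variance_runEstimate_le_of_bounds θ hT hε (by positivity) hsd hθE ?_ hG hl) ?_)
    · rw [hθM]
      linarith
    · rw [hθN, hθV]
      exact hQN
    · rw [hθN, hθV, hθE, hθB]
      -- The budget is the floor of the Markov threshold, and the condition asks only for `budget +
      -- 1`.
      refine le_trans ?_ (Nat.lt_floor_add_one _).le
      have : (G.numEdges : ℝ) ≤ m := Nat.cast_le.2 hG.1
      gcongr

end SignedStream

theorem mainTheorem5 :
    ∃ C : ℝ, 0 < C ∧
      ∀ (n m T DE DV : ℕ) (ε δ : ℝ), 0 < T → 0 < ε → ε ≤ 1 → 0 < δ → δ ≤ 1 / 2 →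
        ∃ (θ : SignedStream.Params n) (b : ℕ),
          (b : ℝ) ≤ C * ((m : ℝ) / T * (DE + Real.sqrt DV) * Real.log n * (1 / ε ^ 2)
            * Real.log (1 / δ)) ∧
          (SignedStream.medianOfMeans θ).UsesAtMostBits
            {l | ∃ G ∈ SignedStream.boundedGraphs n m T DE DV, SignedStream.IsStreamOf l G} b ∧
          ∀ G ∈ SignedStream.boundedGraphs n m T DE DV,
            ∀ l : List (SignedStream.SignedEdge n), SignedStream.IsStreamOf l G →
              ENNReal.ofReal (1 - δ) ≤
                (SignedStream.medianOfMeans θ).outProb (SignedStream.seedLaw θ)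
                  (SignedStream.coinLaw θ) l
                  {R | |R - (G.numTriangles 1 : ℝ)| ≤ ε * (G.numTriangles 1 : ℝ)} := by
  refine ⟨1000000, by norm_num, fun n m T DE DV ε δ hT hε hε1 hδ hδ1 => ?_⟩
  rcases (SignedStream.boundedGraphs n m T DE DV).eq_empty_or_nonempty with h | h
  -- With inconsistent bounds there are no streams to handle, and zero bits suffice, even where the
  -- right side is zero.
  · have hlog : 0 ≤ Real.log n := Real.log_natCast_nonneg n
    have hlogδ : 0 ≤ Real.log (1 / δ) := Real.log_nonneg (by
      rw [le_div_iff₀ hδ]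
      linarith)
    refine ⟨SignedStream.trivialParams n, 0, ?_, ⟨fun _ _ => false, ?_⟩, ?_⟩
    · rw [Nat.cast_zero]
      positivity
    · rintro M ⟨l, ⟨G, hG, -⟩, -⟩
      rw [h] at hG
      exact hG.elim
    · intro G hG
      rw [h] at hG
      exact hG.elim
  · exact SignedStream.exists_params_of_nonempty hT hε hε1 hδ hδ1 h
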